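/- Let $m\ge 2$ and $X_m=\{x_1,\dots,x_m\}$. For $\ell\in\mathbb N$ let $B_\ell$ be the set of cyclically reduced words of length at most $\ell$ in the letters $x_1^{\pm1},\dots,x_m^{\pm1}$. A sequence of random groups $(G_\ell(m,d))$ with $m$ generators at density $d\in\{-\infty\}\cup[0,1]$ is given by $G_\ell(m,d)=\langle X_m\mid R_\ell\rangle$, where $(R_\ell)$ is a sequence of random subsets $R_\ell\subseteq B_\ell$ such that * (permutation invariance) for every $\ell$, the law of $R_\ell$ is invariant under all permutations of the set $B_\ell$; * (density $d$) the random variables $\log_{|B_\ell|}|R_\ell|$ (equal to $-\infty$ when $R_\ell=\emptyset$) converge in probability to the constant $d$ as $\ell\to\infty$. An event depending on $\ell$ holds *asymptotically almost surely* (a.a.s.) if its probability tends to $1$ as $\ell\to\infty$. A *piece* with respect to a set $R$ of relators is a word that appears at least twice as a cyclic subword of the relators in $R$ and their inverses: in two different relators, or in the same relator at two different positions or in opposite directions (a cyclic subword of $r$ is a prefix of a cyclic permutation of $r$). The presentation $\langle X_m\mid R\rangle$ satisfies the small cancellation condition $C'(\lambda)$ if every piece $w$ satisfies $|w|\le\lambda|r|$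 for every relator $r\in R$ such that $w$ is a cyclic subword of $r$ or $r^{-1}$. **Proposition.** Let $0<\lambda<1$ and let $(G_\ell(m,d))$ be a sequence of random groups with $m\ge2$ generators at density $d$. 1. If $d<\lambda/2$, then a.a.s. $G_\ell(m,d)$ satisfies $C'(\lambda)$. 2. If $d>\lambda/2$, then a.a.s. $G_\ell(m,d)$ does not satisfy $C'(\lambda)$. -/

import Mathlib

open Filter Topology MeasureTheory

namespace RandomGroup

/-- Words in the alphabet `x₁^±, …, x_m^±`; the letter `(i, true)` is `xᵢ`, the letter
`(i, false)` is its inverse. -/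
abbrev Word (m : ℕ) : Type := List (Fin m × Bool)

theorem finite_relators (m ℓ : ℕ) :
    {w : Word m | FreeGroup.IsCyclicallyReduced w ∧ w.length ≤ ℓ}.Finite :=
  (List.finite_length_le (Fin m × Bool) ℓ).subset fun _ hw => hw.2

/-- `B_ℓ`: the finite set of cyclically reduced words of length at most `ℓ`. -/
noncomputable def B (m ℓ : ℕ) : Finset (Word m) :=
  (finite_relators m ℓ).toFinset

/-! ### Random subsets and density -/

/-- The density `log_{|E|} |A|` of a subset `A` of a finite set `E`, with value `-∞` when `A` is
empty. -/
noncomputable def density {α : Type*} (E : Finset α) (A : Finset E) : EReal :=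
  if A.card = 0 then ⊥ else ((Real.logb E.card A.card : ℝ) : EReal)

/-- The property `Q_ℓ` holds asymptotically almost surely. -/
def AAS {Ω : ℕ → Type*} [∀ ℓ, MeasurableSpace (Ω ℓ)] (P : ∀ ℓ, Measure (Ω ℓ))
    (Q : ∀ ℓ, Ω ℓ → Prop) : Prop :=
  Tendsto (fun ℓ => P ℓ {ω | Q ℓ ω}) atTop (𝓝 1)

/-- `R` is a random variable with values in the (finite) set of subsets of `E`. -/
def IsRandomSubset {Ω α : Type*} [MeasurableSpace Ω] {E : Finset α} (R : Ω → Finset E) : Prop :=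
  ∀ A : Finset E, MeasurableSet {ω | R ω = A}

/-- The law of the random subset `R` of `E` is invariant under all permutations of `E`. -/
def IsPermutationInvariant {Ω α : Type*} [MeasurableSpace Ω] (P : Measure Ω) {E : Finset α}
    (R : Ω → Finset E) : Prop :=
  ∀ (σ : Equiv.Perm E) (A : Finset E),
    P {ω | R ω = A.map σ.toEmbedding} = P {ω | R ω = A}

/-- The sequence `(R_ℓ)` of random subsets of `(E_ℓ)` is densable with density `d`: the random
variables `log_{|E_ℓ|} |R_ℓ|`, with values in the extended reals, converge in probability to the
constant `d`. (For `|E_ℓ| → ∞` this forces `d ∈ {-∞} ∪ [0, 1]`.) -/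
def IsDensable {Ω : ℕ → Type*} [∀ ℓ, MeasurableSpace (Ω ℓ)] (P : ∀ ℓ, Measure (Ω ℓ))
    {α : Type*} {E : ℕ → Finset α} (R : ∀ ℓ, Ω ℓ → Finset (E ℓ)) (d : EReal) : Prop :=
  ∀ U ∈ 𝓝 d, AAS P fun ℓ ω => density (E ℓ) (R ℓ ω) ∈ U

/-- `(R_ℓ)` is the sequence of relator sets of a sequence of random groups
`G_ℓ(m, d) = ⟨x₁, …, x_m | R_ℓ⟩` with `m` generators at density `d`. -/
structure IsRandomGroupSequence {Ω : ℕ → Type*} [∀ ℓ, MeasurableSpace (Ω ℓ)]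
    (P : ∀ ℓ, Measure (Ω ℓ)) (m : ℕ) (d : EReal) (R : ∀ ℓ, Ω ℓ → Finset (B m ℓ)) : Prop where
  randomSubset : ∀ ℓ, IsRandomSubset (R ℓ)
  permutationInvariant : ∀ ℓ, IsPermutationInvariant (P ℓ) (R ℓ)
  densable : IsDensable P R d

/-- The underlying set of words of a subset of `B_ℓ`. -/
def relators {m ℓ : ℕ} (A : Finset (B m ℓ)) : Set (Word m) :=
  Subtype.val '' (A : Set (B m ℓ))

/-! ### Small cancellation -/

/-- The word `r` or its formal inverse `r⁻¹`. -/
def orient {m : ℕ} (r : Word m) : Bool → Word m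
  | true => r
  | false => FreeGroup.invRev r

/-- `w` is the cyclic subword of `r` (if `ε = true`) or of `r⁻¹` (if `ε = false`) that starts
at position `i`; its length is at most that of `r`. -/
def OccursAt {m : ℕ} (w r : Word m) (ε : Bool) (i : ℕ) : Prop :=
  i < r.length ∧ w <+: (orient r ε).rotate i

/-- A piece with respect to a set `S` of relators: a cyclic subword of the relators and their
inverses that appears at least twice, in different relators, or in the same relator at different
positions or in opposite directions. -/
def IsPiece {m : ℕ} (S : Set (Word m)) (w : Word m) : Prop :=
  ∃ r₁ ∈ S, ∃ r₂ ∈ S, ∃ (ε₁ ε₂ : Bool) (i₁ i₂ : ℕ),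
    OccursAt w r₁ ε₁ i₁ ∧ OccursAt w r₂ ε₂ i₂ ∧ (r₁, ε₁, i₁) ≠ (r₂, ε₂, i₂)

/-- The small cancellation condition `C'(lam)`: the length of a piece is at most `lam` times the
length of any relator in which it appears. -/
def SmallCancellation {m : ℕ} (lam : ℝ) (S : Set (Word m)) : Prop :=
  ∀ w, IsPiece S w → ∀ r ∈ S, (∃ (ε : Bool) (i : ℕ), OccursAt w r ε i) →
    (w.length : ℝ) ≤ lam * (r.length : ℝ)

end RandomGroup

/-! Write `q = 2m - 1` and `N = |B_ℓ|`; then `N ≥ q ^ (ℓ - 2)`. By permutation invariance, the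
random set is uniform among the `k`-subsets of `B_ℓ` once its cardinality `k` is known. So it
suffices to bound the proportion of bad `k`-subsets uniformly over the typical `k`
(`aas_not_of_card_le`). Choosing a real `x` strictly between `d` and `λ/2`, the typical `k` satisfy
`k ≤ N ^ x` in the first half and `k ≥ N ^ x` in the second.

Below the threshold a union bound suffices. If `C'(λ)` fails, then either two different relators
share a long cyclic subword, or one relator contains such a subword twice. Up to polynomial factors
there are `q ^ ((2 - λ)ℓ)` such pairs and `q ^ ((1 - λ/2)ℓ)` such single relators. They are chosen
with probability at most `(k/N)²` and `k/N`, so the expected numbers are about `q ^ ((2x - λ)ℓ)` and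
`q ^ ((x - λ/2)ℓ)`, and both tend to `0`. In the self-overlap case only half of the repeated letters
are known to be determined (`card_commonSubword_self_le`), which is just enough.

Above the threshold the birthday paradox applies. Under `C'(λ)` the relators have distinct prefixes
of length `⌊λℓ⌋ + 1`, and there are only `M ≈ q ^ (λℓ)` possible prefixes. The prefix classes have
unequal sizes, but a Maclaurin-type inequality still bounds the proportion of collision-free
`k`-sets by `exp(-k(k-1)/(4M))` (`card_injSets_le`), and `k²/M → ∞`. -/

namespace RandomGroup

/-! ### Reduced words -/

/-- The formal inverse of a letter. -/
def invLetter {m : ℕ} (x : Fin m × Bool) : Fin m × Bool := (x.1, !x.2)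

/-- The letter `x` or its formal inverse. -/
def orientLetter {m : ℕ} (ε : Bool) (x : Fin m × Bool) : Fin m × Bool :=
  bif ε then x else invLetter x

theorem invLetter_ne {m : ℕ} (x : Fin m × Bool) : invLetter x ≠ x := by
  obtain ⟨a, b⟩ := x
  simp [invLetter]

@[simp] theorem invLetter_invLetter {m : ℕ} (x : Fin m × Bool) :
    invLetter (invLetter x) = x := by
  simp [invLetter]

@[simp] theorem orientLetter_orientLetter {m : ℕ} (ε : Bool) (x : Fin m × Bool) :
    orientLetter ε (orientLetter ε x) = x := by
  cases ε <;> simp [orientLetter]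

theorem ne_invLetter_iff {m : ℕ} (x y : Fin m × Bool) :
    x ≠ invLetter y ↔ (x.1 = y.1 → x.2 = y.2) := by
  obtain ⟨a, b⟩ := x
  obtain ⟨c, e⟩ := y
  simp [invLetter]

theorem ne_invLetter_comm {m : ℕ} {x y : Fin m × Bool} :
    x ≠ invLetter y ↔ y ≠ invLetter x := by
  rw [ne_invLetter_iff, ne_invLetter_iff]
  exact ⟨fun h e => (h e.symm).symm, fun h e => (h e.symm).symm⟩

theorem isReduced_take {m : ℕ} {w : Word m} (h : FreeGroup.IsReduced w) (n : ℕ) :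
    FreeGroup.IsReduced (w.take n) :=
  h.infix (List.take_prefix n w).isInfix

/-- In a set of reduced words of length `n` in which the letters at the positions in `J` are
determined by the preceding letters, only the other positions contribute a factor `2m - 1`. -/
theorem card_le_of_determined {m : ℕ} (n : ℕ) (J : Finset ℕ) (hJ : J ⊆ Finset.range n)
    (S : Finset (Word m)) (hlen : ∀ w ∈ S, w.length = n)
    (hred : ∀ w ∈ S, FreeGroup.IsReduced w)
    (hdet : ∀ u ∈ S, ∀ v ∈ S, ∀ p ∈ J, u.take p = v.take p → u[p]? = v[p]?)
    (hm : 1 ≤ m) :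
    S.card ≤ 2 * m * (2 * m - 1) ^ (n - J.card) := by
  induction n generalizing J S with
  | zero =>
    have : S.card ≤ 1 := Finset.card_le_one.2 fun a ha b hb => by
      rw [List.eq_nil_of_length_eq_zero (hlen a ha), List.eq_nil_of_length_eq_zero (hlen b hb)]
    simp only [zero_le, Nat.sub_eq_zero_of_le, pow_zero]
    omega
  | succ n ih =>
    have hJn : J.card ≤ n + 1 := by simpa using Finset.card_le_card hJ
    have split : ∀ u ∈ S, ∀ v ∈ S, u.take n = v.take n → u[n]? = v[n]? → u = v := by
      intro u hu v hv h1 h2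
      have hu' := hlen u hu
      have hv' := hlen v hv
      refine List.ext_getElem? fun i => ?_
      rcases lt_trichotomy i n with h | rfl | h
      · have := congrArg (fun l => l[i]?) h1
        simpa only [List.getElem?_take_of_lt h] using this
      · exact h2
      · rw [List.getElem?_eq_none (by omega), List.getElem?_eq_none (by omega)]
    have key := ih (J.filter (· < n)) (fun x hx => by simpa using (Finset.mem_filter.1 hx).2)
      (S.image (List.take n))
      (by
        simp only [Finset.mem_image]
        rintro _ ⟨w, hw, rfl⟩
        simp [hlen w hw])
      (by
        simp only [Finset.mem_image]
        rintro _ ⟨w, hw, rfl⟩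
        exact isReduced_take (hred w hw) n)
      (by
        simp only [Finset.mem_image, Finset.mem_filter]
        rintro _ ⟨u, hu, rfl⟩ _ ⟨v, hv, rfl⟩ p ⟨hp, hpn⟩ h
        simp only [List.take_take, min_eq_left hpn.le] at h
        rw [List.getElem?_take_of_lt hpn, List.getElem?_take_of_lt hpn]
        exact hdet u hu v hv p hp h)
    by_cases hn : n ∈ J
    · have hinj : Set.InjOn (List.take n) (S : Set (Word m)) := fun u hu v hv h =>
        split u hu v hv h (hdet u hu v hv n hn h)
      rw [Finset.card_image_of_injOn hinj] at key
      have hJ' : J = insert n (J.filter (· < n)) := by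
        ext x
        have := fun h => Finset.mem_range.1 (@hJ x h)
        simp only [Finset.mem_insert, Finset.mem_filter]
        constructor
        · intro h
          have := this h
          by_cases hx : x = n
          · exact Or.inl hx
          · exact Or.inr ⟨h, by omega⟩
        · rintro (rfl | h)
          · exact hn
          · exact h.1
      have : J.card = (J.filter (· < n)).card + 1 := by
        conv_lhs => rw [hJ']
        rw [Finset.card_insert_of_notMem (by simp)]
      rw [this, Nat.add_sub_add_right]
      exact key
    · have hJ' : J.filter (· < n) = J := by
        refine Finset.filter_true_of_mem fun x hx => ?_
        have := Finset.mem_range.1 (hJ hx)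
        have : x ≠ n := fun h => hn (h ▸ hx)
        omega
      rw [hJ'] at key
      have hJc : J.card ≤ n := by
        rw [← hJ']
        refine (Finset.card_le_card (t := Finset.range n) fun x hx => ?_).trans (by simp)
        simpa using (Finset.mem_filter.1 hx).2
      -- A first letter has no predecessor, which gives the factor `2m`; every later free letter has
      -- only `2m - 1` choices.
      rcases Nat.eq_zero_or_pos n with rfl | hpos
      · have : S.card ≤ (Finset.univ : Finset (Option (Fin m × Bool))).card - 1 := by
          rw [← Finset.card_erase_of_mem (Finset.mem_univ none)]
          refine Finset.card_le_card_of_injOn (fun u => u[0]?) (fun u hu => ?_)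
            (fun u hu v hv h => split u hu v hv (by simp) h)
          have := hlen u hu
          rw [Finset.mem_coe, Finset.mem_erase]
          refine ⟨?_, Finset.mem_univ _⟩
          simp [this]
        simp only [Finset.card_univ, Fintype.card_option, Fintype.card_prod, Fintype.card_fin,
          Fintype.card_bool, add_tsub_cancel_right] at this
        have h2 : 1 ≤ (2 * m - 1) ^ (0 + 1 - J.card) := Nat.one_le_pow _ _ (by omega)
        nlinarith
      · have hfib : ∀ b ∈ S.image (List.take n),
            (S.filter fun a => a.take n = b).card ≤ 2 * m - 1 := by
          intro b hb
          obtain ⟨w, hw, rfl⟩ := Finset.mem_image.1 hb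
          have hwl := hlen w hw
          -- Of the `2m + 1` values of `u[n]?`, two are impossible: `none`, and the inverse of the
          -- preceding letter.
          have hc : (Finset.univ.erase (some (invLetter (w[n - 1]'(by omega))))).card = 2 * m := by
            rw [Finset.card_erase_of_mem (Finset.mem_univ _)]
            simp [Fintype.card_option]
            omega
          have hc' : ((Finset.univ.erase (some (invLetter (w[n - 1]'(by omega))))).erase
              none).card = 2 * m - 1 := by
            rw [Finset.card_erase_of_mem (by simp), hc]
          rw [← hc']
          refine Finset.card_le_card_of_injOn (fun u => u[n]?) (fun u hu => ?_)
            (fun u hu v hv h => ?_)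
          · obtain ⟨hu, huw⟩ := Finset.mem_filter.1 hu
            have hul := hlen u hu
            have e : u[n - 1]'(by omega) = w[n - 1]'(by omega) := by
              have := congrArg (fun l => l[n - 1]?) huw
              simp only [List.getElem?_take_of_lt (show n - 1 < n by omega)] at this
              rw [List.getElem?_eq_getElem (by omega), List.getElem?_eq_getElem (by omega)] at this
              simpa using this
            simp only [Finset.coe_erase, Set.mem_sdiff, Set.mem_singleton_iff]
            rw [List.getElem?_eq_getElem (by omega)]
            refine ⟨⟨by simp, ?_⟩, by simp⟩
            rw [← e]
            simp only [Option.some.injEq]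
            rw [← ne_eq, ne_invLetter_comm, ne_invLetter_iff]
            have := List.isChain_iff_getElem.1 (hred u hu) (n - 1) (by omega)
            simpa [show n - 1 + 1 = n by omega] using this
          · obtain ⟨hu, huw⟩ := Finset.mem_filter.1 hu
            obtain ⟨hv, hvw⟩ := Finset.mem_filter.1 hv
            exact split u hu v hv (huw.trans hvw.symm) h
        have := Finset.card_le_mul_card_image S (2 * m - 1) hfib
        rw [show n + 1 - J.card = (n - J.card) + 1 by omega, pow_succ]
        nlinarith

/-- The set of reduced words of length `n`. -/
noncomputable def reducedWords (m n : ℕ) : Finset (Word m) :=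
  ((List.finite_length_eq (Fin m × Bool) n).subset
    (t := {w : Word m | w.length = n ∧ FreeGroup.IsReduced w}) fun _ hw => hw.1).toFinset

@[simp] theorem mem_reducedWords {m n : ℕ} {w : Word m} :
    w ∈ reducedWords m n ↔ w.length = n ∧ FreeGroup.IsReduced w := by
  simp [reducedWords]

theorem card_reducedWords_le {m : ℕ} (hm : 1 ≤ m) (n : ℕ) :
    (reducedWords m n).card ≤ 2 * m * (2 * m - 1) ^ n := by
  simpa using card_le_of_determined n ∅ (by simp) (reducedWords m n)
    (fun w hw => (mem_reducedWords.1 hw).1) (fun w hw => (mem_reducedWords.1 hw).2) (by simp) hm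

@[simp] theorem mem_B {m ℓ : ℕ} {w : Word m} :
    w ∈ B m ℓ ↔ FreeGroup.IsCyclicallyReduced w ∧ w.length ≤ ℓ := by
  simp [B]

/-- Each reduced word extends to the left in `2m - 1` ways. The last letter is kept fixed so that a
single further letter can later make the word cyclically reduced. -/
theorem pow_le_card_reducedWords_getLast {m : ℕ} (x : Fin m × Bool) (n : ℕ) :
    (2 * m - 1) ^ n ≤ ((reducedWords m (n + 1)).filter fun w => w.getLast? = some x).card := by
  induction n with
  | zero =>
    simp only [pow_zero, Nat.one_le_iff_ne_zero, ne_eq, Finset.card_eq_zero]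
    refine Finset.ne_empty_of_mem (a := [x]) ?_
    simp [FreeGroup.IsReduced]
  | succ n ih =>
    have h := Finset.mul_card_image_le_card_of_maps_to (f := List.tail)
      (s := (reducedWords m (n + 1 + 1)).filter fun w => w.getLast? = some x)
      (t := (reducedWords m (n + 1)).filter fun w => w.getLast? = some x)
      (by
        intro w hw
        simp only [Finset.mem_filter, mem_reducedWords] at hw ⊢
        obtain ⟨⟨hl, hr⟩, hx⟩ := hw
        match w, hl with
        | a :: b :: l, hl =>
          refine ⟨⟨by simpa using hl, ?_⟩, by simpa [List.getLast?_cons_cons] using hx⟩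
          exact (List.isChain_cons_cons.1 hr).2) (2 * m - 1) (by
        intro w hw
        simp only [Finset.mem_filter, mem_reducedWords] at hw
        obtain ⟨⟨hl, hr⟩, hx⟩ := hw
        match w, hl with
        | b :: l, hl =>
          have hc : ((Finset.univ : Finset (Fin m × Bool)).erase (invLetter b)).card
              = 2 * m - 1 := by
            rw [Finset.card_erase_of_mem (Finset.mem_univ _)]
            simp [mul_comm]
          rw [← hc]
          refine Finset.card_le_card_of_injOn (fun a => a :: b :: l) (fun a ha => ?_)
            (fun a _ a' _ h => (List.cons.inj h).1)
          simp only [Finset.coe_erase, Finset.coe_univ, Set.mem_sdiff, Set.mem_singleton_iff] at ha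
          simp only [Finset.coe_filter, Finset.mem_filter, mem_reducedWords, Set.mem_ofPred_eq,
            List.tail_cons, and_true]
          refine ⟨⟨by simpa using hl, ?_⟩, by simpa [List.getLast?_cons_cons] using hx⟩
          exact List.isChain_cons_cons.2 ⟨(ne_invLetter_iff a b).1 ha.2, hr⟩)
    rw [pow_succ, mul_comm]
    exact (Nat.mul_le_mul_left _ ih).trans h

theorem pow_le_card_B {m : ℕ} (hm : 2 ≤ m) {ℓ : ℕ} (hℓ : 2 ≤ ℓ) :
    (2 * m - 1) ^ (ℓ - 2) ≤ (B m ℓ).card := by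
  let x : Fin m × Bool := (⟨0, by omega⟩, true)
  let y : Fin m × Bool := (⟨1, by omega⟩, true)
  have hxy : x.1 ≠ y.1 := by simp [x, y]
  refine (pow_le_card_reducedWords_getLast x (ℓ - 2)).trans ?_
  -- Prepending `x` to a word ending in `x` causes no cyclic cancellation. If the word begins with
  -- `x⁻¹`, a different generator `y` is used, which cancels at neither end.
  let c : Word m → Fin m × Bool := fun w => if w.head? = some (invLetter x) then y else x
  refine Finset.card_le_card_of_injOn (fun w => c w :: w) (fun w hw => ?_)
    (fun w _ w' _ h => (List.cons.inj h).2)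
  simp only [Finset.coe_filter, mem_reducedWords, Set.mem_ofPred_eq] at hw
  obtain ⟨⟨hl, hr⟩, hx⟩ := hw
  match w, hl with
  | b :: l, hl =>
    simp only [Finset.mem_coe, mem_B]
    refine ⟨⟨List.isChain_cons_cons.2 ⟨?_, hr⟩, ?_⟩, by simp at hl ⊢; omega⟩
    · by_cases h : b = invLetter x
      · subst h
        intro h
        exact absurd (by simpa [c, invLetter] using h) hxy.symm
      · rw [← ne_invLetter_iff]
        simp only [c, List.head?_cons, Option.some.injEq, h, if_false]
        rw [ne_invLetter_comm]
        exact h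
    · rw [List.getLast?_cons_cons, hx]
      simp only [Option.mem_def, Option.some.injEq, List.head?_cons, forall_eq']
      intro h
      simp only [c] at h ⊢
      split_ifs at h ⊢ with h'
      · exact absurd h hxy
      · rfl

/-! ### Random subsets of a finite set -/

/-- Removing `F` leaves a `(k - |F|)`-subset of the complement, and `C(N,k) C(k,f) = C(N,f)
C(N-f,k-f)`. The product form avoids division and covers `|F| > k`. -/
theorem card_superset_mul_choose_le {α : Type*} [Fintype α] [DecidableEq α] (F : Finset α)
    (k : ℕ) :
    ((Finset.powersetCard k Finset.univ).filter fun A => F ⊆ A).card *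
        (Fintype.card α).choose F.card ≤
      (Fintype.card α).choose k * k.choose F.card := by
  rcases le_or_gt F.card k with h | h
  · rw [Nat.choose_mul h, mul_comm]
    refine Nat.mul_le_mul_left _ ?_
    rw [← Finset.card_univ, ← Finset.card_sdiff_of_subset (Finset.subset_univ F),
      ← Finset.card_powersetCard]
    refine Finset.card_le_card_of_injOn (fun A => A \ F) (fun A hA => ?_)
      (fun A hA A' hA' e => ?_)
    · rw [Finset.mem_coe, Finset.mem_filter, Finset.mem_powersetCard] at hA
      rw [Finset.mem_coe, Finset.mem_powersetCard]
      exact ⟨Finset.sdiff_subset_sdiff hA.1.1 le_rfl, by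
        rw [Finset.card_sdiff_of_subset hA.2, hA.1.2]⟩
    · rw [Finset.mem_coe, Finset.mem_filter] at hA hA'
      rw [← Finset.sdiff_union_of_subset hA.2, ← Finset.sdiff_union_of_subset hA'.2]
      exact congrArg (· ∪ F) e
  · rw [Finset.filter_false_of_mem, Finset.card_empty, zero_mul]
    · exact Nat.zero_le _
    · intro A hA hF
      have := Finset.card_le_card hF
      rw [(Finset.mem_powersetCard.1 hA).2] at this
      omega

theorem card_mem_le {α : Type*} [Fintype α] [DecidableEq α] (a : α) (k : ℕ) :
    (((Finset.powersetCard k Finset.univ).filter fun A => a ∈ A).card : ℝ) ≤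
      k / Fintype.card α * (Fintype.card α).choose k := by
  have h := card_superset_mul_choose_le {a} k
  simp only [Finset.singleton_subset_iff, Finset.card_singleton, Nat.choose_one_right] at h
  have hN : (0 : ℝ) < Fintype.card α := by exact_mod_cast Fintype.card_pos_iff.2 ⟨a⟩
  rw [div_mul_eq_mul_div, le_div_iff₀ hN, mul_comm (k : ℝ)]
  exact_mod_cast h

theorem card_pair_mem_le {α : Type*} [Fintype α] [DecidableEq α] {a b : α} (hab : a ≠ b)
    (k : ℕ) :
    (((Finset.powersetCard k Finset.univ).filter fun A => a ∈ A ∧ b ∈ A).card : ℝ) ≤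
      (k / Fintype.card α) ^ 2 * (Fintype.card α).choose k := by
  have h := card_superset_mul_choose_le {a, b} k
  simp only [Finset.insert_subset_iff, Finset.singleton_subset_iff, Finset.card_pair hab] at h
  set N := Fintype.card α
  set c := ((Finset.powersetCard k Finset.univ).filter fun A : Finset α => a ∈ A ∧ b ∈ A).card
  have hN : 1 < N := Fintype.one_lt_card_iff.2 ⟨a, b, hab⟩
  have hN' : (1 : ℝ) < N := by exact_mod_cast hN
  rcases lt_or_ge N k with hk | hk
  · rw [Nat.choose_eq_zero_of_lt hk, zero_mul] at h
    have : c = 0 := by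
      have := Nat.choose_pos (show 2 ≤ N by omega)
      rcases Nat.mul_eq_zero.1 (Nat.le_zero.1 h) with h | h
      · exact h
      · omega
    rw [this, Nat.choose_eq_zero_of_lt hk]
    simp
  · have h' : (c : ℝ) * (N * (N - 1) / 2) ≤ N.choose k * (k * (k - 1) / 2) := by
      rw [← Nat.cast_choose_two, ← Nat.cast_choose_two]
      exact_mod_cast h
    have hk' : (k : ℝ) ≤ N := by exact_mod_cast hk
    have hC : (0 : ℝ) ≤ N.choose k := Nat.cast_nonneg _
    have hk0 : (0 : ℝ) ≤ k := Nat.cast_nonneg _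
    have h1 : (c : ℝ) ≤ N.choose k * (k * (k - 1)) / (N * (N - 1)) := by
      rw [le_div_iff₀ (by nlinarith)]
      linarith
    refine h1.trans ?_
    rw [div_pow, div_mul_eq_mul_div, div_le_div_iff₀ (by nlinarith) (by positivity)]
    -- Sampling without replacement is negatively correlated: `(k-1)/(N-1) ≤ k/N` because `k ≤ N`.
    have h2 : (k * (k - 1)) * (N : ℝ) ^ 2 ≤ k ^ 2 * (N * (N - 1)) := by
      have : 0 ≤ (k : ℝ) * N * (N - k) := by
        have : (0 : ℝ) ≤ N - k := by linarith
        positivity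
      nlinarith
    calc _ = (N.choose k : ℝ) * ((k * (k - 1)) * (N : ℝ) ^ 2) := by ring
      _ ≤ (N.choose k : ℝ) * (k ^ 2 * (N * (N - 1))) := by gcongr
      _ = _ := by ring

/-! ### From proportions of `k`-subsets to probabilities. -/

theorem measureReal_mem_eq_sum {Ω α : Type*} [MeasurableSpace Ω] (P : Measure Ω)
    [IsFiniteMeasure P] {E : Finset α} (R : Ω → Finset E) (hR : IsRandomSubset R)
    (S : Finset (Finset E)) :
    P.real {ω | R ω ∈ S} = ∑ A ∈ S, P.real {ω | R ω = A} := by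
  rw [← measureReal_biUnion_finset]
  · congr 1
    ext ω
    simp
  · intro A _ A' _ hAA'
    refine Set.disjoint_left.2 fun ω h h' => hAA' ?_
    exact (show R ω = A from h).symm.trans h'
  · exact fun A _ => hR A

theorem exists_perm_map_eq {α : Type*} [Fintype α] {A A' : Finset α}
    (h : A.card = A'.card) : ∃ σ : Equiv.Perm α, A.map σ.toEmbedding = A' := by
  classical
  let e : {x // x ∈ A} ≃ {x // x ∈ A'} := Finset.equivOfCardEq h
  refine ⟨e.extendSubtype, Finset.eq_of_subset_of_card_le (fun x hx => ?_) (by simp [h])⟩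
  obtain ⟨y, hy, rfl⟩ := Finset.mem_map.1 hx
  exact e.extendSubtype_mem y hy

/-- If a property is satisfied by a proportion at most `ε` of the subsets of cardinality `k`, for
every `k ∈ K`, then a permutation invariant random subset with cardinality in `K` satisfies it
with probability at most `ε`. -/
theorem measureReal_le_of_card_le {Ω α : Type*} [MeasurableSpace Ω] (P : Measure Ω)
    [IsProbabilityMeasure P] {E : Finset α} (R : Ω → Finset E) (hR : IsRandomSubset R)
    (hinv : IsPermutationInvariant P R) (F : Finset E → Prop) [DecidablePred F] (K : Set ℕ)
    (ε : ℝ) (hε : 0 ≤ ε)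
    (h : ∀ k ∈ K, (((Finset.powersetCard k Finset.univ).filter F).card : ℝ) ≤
      ε * E.card.choose k) :
    P.real {ω | F (R ω) ∧ (R ω).card ∈ K} ≤ ε := by
  classical
  set p : Finset E → ℝ := fun A => P.real {ω | R ω = A} with hp
  have hp0 : ∀ A, 0 ≤ p A := fun A => measureReal_nonneg
  -- Permutations act transitively on subsets of a given cardinality, so the law is constant on each
  -- layer and the comparison can be made layer by layer.
  have hpc : ∀ A A', A.card = A'.card → p A = p A' := by
    intro A A' hAA'
    obtain ⟨σ, rfl⟩ := exists_perm_map_eq hAA'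
    simp only [hp, measureReal_def, hinv σ A]
  have hsum : ∑ A, p A ≤ 1 := by
    rw [← measureReal_mem_eq_sum P R hR]
    exact measureReal_le_one
  have hk : ∀ k, ∑ A ∈ (Finset.univ.filter fun A => F A ∧ A.card ∈ K) with A.card = k, p A ≤
      ε * ∑ A with A.card = k, p A := by
    intro k
    by_cases hkK : k ∈ K
    · have e1 : (Finset.univ.filter fun A : Finset E => F A ∧ A.card ∈ K).filter
          (fun A => A.card = k) = (Finset.powersetCard k Finset.univ).filter F := by
        ext A
        simp only [Finset.mem_filter, Finset.mem_univ, true_and, Finset.mem_powersetCard,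
          Finset.subset_univ]
        constructor
        · rintro ⟨⟨h1, -⟩, h2⟩
          exact ⟨h2, h1⟩
        · rintro ⟨h2, h1⟩
          exact ⟨⟨h1, h2 ▸ hkK⟩, h2⟩
      have e2 : Finset.univ.filter (fun A : Finset E => A.card = k) =
          Finset.powersetCard k Finset.univ := by
        ext A
        simp [Finset.mem_powersetCard]
      rw [e1, e2]
      rcases (Finset.powersetCard k (Finset.univ : Finset E)).eq_empty_or_nonempty with h0 | ⟨A₀, hA₀⟩
      · rw [h0]
        simp
      · have hc : ∀ A ∈ Finset.powersetCard k (Finset.univ : Finset E), p A = p A₀ :=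
          fun A hA => hpc _ _
            ((Finset.mem_powersetCard.1 hA).2.trans (Finset.mem_powersetCard.1 hA₀).2.symm)
        rw [Finset.sum_congr rfl hc,
          Finset.sum_congr rfl (fun A hA => hc A (Finset.mem_filter.1 hA).1)]
        simp only [Finset.sum_const, nsmul_eq_mul, Finset.card_powersetCard, Finset.card_univ,
          Fintype.card_coe]
        rw [← mul_assoc]
        exact mul_le_mul_of_nonneg_right (h k hkK) (hp0 A₀)
    · rw [Finset.filter_false_of_mem, Finset.sum_empty]
      · exact mul_nonneg hε (Finset.sum_nonneg fun A _ => hp0 A)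
      · intro A hA hAk
        exact hkK (hAk ▸ (Finset.mem_filter.1 hA).2.2)
  have e : {ω | F (R ω) ∧ (R ω).card ∈ K} =
      {ω | R ω ∈ Finset.univ.filter fun A => F A ∧ A.card ∈ K} := by
    ext ω
    simp
  rw [e, measureReal_mem_eq_sum P R hR]
  have maps : ∀ S : Finset (Finset E), ∀ A ∈ S, A.card ∈ Finset.range (E.card + 1) := by
    intro S A _
    have := Finset.card_le_univ A
    rw [Fintype.card_coe] at this
    exact Finset.mem_range.2 (by omega)
  rw [← Finset.sum_fiberwise_of_maps_to (maps _)]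
  refine (Finset.sum_le_sum fun k _ => hk k).trans ?_
  rw [← Finset.mul_sum, Finset.sum_fiberwise_of_maps_to (maps _)]
  nlinarith

/-- Transfer of a counting estimate to an asymptotically almost sure statement. -/
theorem aas_not_of_card_le {Ω : ℕ → Type*} [∀ ℓ, MeasurableSpace (Ω ℓ)]
    (P : ∀ ℓ, Measure (Ω ℓ)) [∀ ℓ, IsProbabilityMeasure (P ℓ)] {α : Type*}
    {E : ℕ → Finset α} (R : ∀ ℓ, Ω ℓ → Finset (E ℓ)) (hR : ∀ ℓ, IsRandomSubset (R ℓ))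
    (hinv : ∀ ℓ, IsPermutationInvariant (P ℓ) (R ℓ)) (F : ∀ ℓ, Finset (E ℓ) → Prop)
    [∀ ℓ, DecidablePred (F ℓ)] (K : ℕ → Set ℕ)
    (hK : AAS P fun ℓ ω => (R ℓ ω).card ∈ K ℓ) (ε : ℕ → ℝ) (hε : Tendsto ε atTop (𝓝 0))
    (h : ∀ᶠ ℓ in atTop, ∀ k ∈ K ℓ,
      (((Finset.powersetCard k Finset.univ).filter (F ℓ)).card : ℝ) ≤
        ε ℓ * (E ℓ).card.choose k)
    (hε0 : ∀ᶠ ℓ in atTop, 0 ≤ ε ℓ) :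
    AAS P fun ℓ ω => ¬ F ℓ (R ℓ ω) := by
  have hK' : Tendsto (fun ℓ => (P ℓ).real {ω | (R ℓ ω).card ∈ K ℓ}) atTop (𝓝 1) := by
    exact (ENNReal.tendsto_toReal ENNReal.one_ne_top).comp hK
  have hlow : Tendsto (fun ℓ => (P ℓ).real {ω | (R ℓ ω).card ∈ K ℓ} - ε ℓ) atTop (𝓝 1) := by
    simpa using hK'.sub hε
  have main : Tendsto (fun ℓ => (P ℓ).real {ω | ¬ F ℓ (R ℓ ω)}) atTop (𝓝 1) := by
    refine tendsto_of_tendsto_of_tendsto_of_le_of_le' hlow tendsto_const_nhds ?_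
      (Eventually.of_forall fun ℓ => measureReal_le_one)
    filter_upwards [h, hε0] with ℓ hℓ hℓ0
    have h1 := measureReal_le_of_card_le (P ℓ) (R ℓ) (hR ℓ) (hinv ℓ) (F ℓ) (K ℓ) (ε ℓ) hℓ0 hℓ
    have h2 : (P ℓ).real {ω | (R ℓ ω).card ∈ K ℓ} ≤
        (P ℓ).real ({ω | ¬ F ℓ (R ℓ ω)} ∪ {ω | F ℓ (R ℓ ω) ∧ (R ℓ ω).card ∈ K ℓ}) := by
      refine measureReal_mono fun ω hω => ?_
      by_cases hF : F ℓ (R ℓ ω)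
      · exact Or.inr ⟨hF, hω⟩
      · exact Or.inl hF
    have h3 := measureReal_union_le (μ := P ℓ) {ω | ¬ F ℓ (R ℓ ω)}
      {ω | F ℓ (R ℓ ω) ∧ (R ℓ ω).card ∈ K ℓ}
    linarith
  have := ENNReal.tendsto_ofReal main
  simpa [AAS, measureReal_def] using this

/-! ### Injective subsets and the birthday estimate -/

section Birthday

variable {α β : Type*} [Fintype α] [DecidableEq β] (c : α → β)

open Classical in
/-- The subsets of cardinality `k` on which `c` is injective. -/
noncomputable def injSets (k : ℕ) : Finset (Finset α) :=
  (Finset.powersetCard k Finset.univ).filter fun A => Set.InjOn c A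

/-- The elements whose value under `c` is not attained on `A`. -/
def freeElements (A : Finset α) : Finset α := Finset.univ.filter fun a => c a ∉ A.image c

/-- The number of elements with the same value under `c` as `a`. -/
def fiberCard (a : α) : ℕ := (Finset.univ.filter fun x => c x = c a).card

variable {c}

theorem mem_injSets {k : ℕ} {A : Finset α} :
    A ∈ injSets c k ↔ A.card = k ∧ Set.InjOn c A := by
  simp [injSets, Finset.mem_powersetCard]

theorem mem_freeElements {A : Finset α} {a : α} :
    a ∈ freeElements c A ↔ ∀ x ∈ A, c x ≠ c a := by
  simp [freeElements]

/-- Double counting of pointed sets: erasing the marked point of an injective `(k+1)`-set leaves an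
injective `k`-set for which that point is free. -/
theorem sum_injSets_succ [DecidableEq α] {k : ℕ} (φ : Finset α → α → ℝ) :
    ∑ A ∈ injSets c (k + 1), ∑ a ∈ A, φ A a =
      ∑ A ∈ injSets c k, ∑ a ∈ freeElements c A, φ (insert a A) a := by
  rw [Finset.sum_sigma', Finset.sum_sigma']
  refine Finset.sum_bij' (fun x _ => ⟨x.1.erase x.2, x.2⟩) (fun x _ => ⟨insert x.2 x.1, x.2⟩)
    ?_ ?_ ?_ ?_ ?_
  · rintro ⟨A, a⟩ h
    simp only [Finset.mem_sigma, mem_injSets, mem_freeElements] at h ⊢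
    obtain ⟨⟨h1, h2⟩, h3⟩ := h
    refine ⟨⟨by rw [Finset.card_erase_of_mem h3, h1]; rfl, h2.mono (by simp)⟩, fun x hx e => ?_⟩
    exact Finset.ne_of_mem_erase hx (h2 (Finset.mem_of_mem_erase hx) h3 e)
  · rintro ⟨A, a⟩ h
    simp only [Finset.mem_sigma, mem_injSets, mem_freeElements] at h ⊢
    obtain ⟨⟨h1, h2⟩, h3⟩ := h
    have ha : a ∉ A := fun ha => h3 a ha rfl
    refine ⟨⟨by rw [Finset.card_insert_of_notMem ha, h1], ?_⟩, by simp⟩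
    rw [Finset.coe_insert, Set.injOn_insert (by simpa using ha)]
    refine ⟨h2, ?_⟩
    rintro ⟨x, hx, e⟩
    exact h3 x hx e
  · rintro ⟨A, a⟩ h
    simp [Finset.insert_erase (Finset.mem_sigma.1 h).2]
  · rintro ⟨A, a⟩ h
    have h3 := mem_freeElements.1 (Finset.mem_sigma.1 h).2
    have ha : a ∉ A := fun ha => h3 a ha rfl
    simp [Finset.erase_insert ha]
  · rintro ⟨A, a⟩ h
    simp [Finset.insert_erase (Finset.mem_sigma.1 h).2]

theorem card_freeElements_insert [DecidableEq α] {A : Finset α} {a : α} (ha : a ∈ freeElements c A) :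
    ((freeElements c (insert a A)).card : ℝ) = (freeElements c A).card - fiberCard c a := by
  rw [eq_sub_iff_add_eq]
  norm_cast
  rw [fiberCard, ← Finset.card_union_of_disjoint]
  · congr 1
    ext x
    have ha' := mem_freeElements.1 ha
    simp only [Finset.mem_union, mem_freeElements, Finset.mem_insert, forall_eq_or_imp,
      Finset.mem_filter, Finset.mem_univ, true_and]
    constructor
    · rintro (h | h)
      · exact h.2
      · rw [h]
        exact ha'
    · intro h
      by_cases hx : c x = c a
      · exact Or.inr hx
      · exact Or.inl ⟨fun e => hx e.symm, h⟩
  · refine Finset.disjoint_left.2 fun x hx hx' => ?_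
    exact mem_freeElements.1 hx a (by simp) (Finset.mem_filter.1 hx').2.symm

theorem sum_fiberCard {A : Finset α} (hA : Set.InjOn c A) :
    ∑ a ∈ A, (fiberCard c a : ℝ) = Fintype.card α - (freeElements c A).card := by
  rw [eq_sub_iff_add_eq]
  norm_cast
  have h : ∑ a ∈ A, fiberCard c a = (Finset.univ.filter fun x => c x ∈ A.image c).card := by
    rw [Finset.card_eq_sum_card_fiberwise (f := c) (t := A.image c)
      (fun x hx => by simpa using hx), Finset.sum_image hA]
    refine Finset.sum_congr rfl fun a ha => ?_
    rw [fiberCard, Finset.filter_filter]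
    congr 1
    ext x
    simp only [Finset.mem_filter, Finset.mem_univ, true_and]
    exact ⟨fun h => ⟨h ▸ Finset.mem_image_of_mem c ha, h⟩, fun h => h.2⟩
  rw [h, freeElements, Finset.card_filter_add_card_filter_not, Finset.card_univ]

/-- The free elements form exactly `M - k` full classes, where `M` is the number of classes. The sum
on the right is the sum of their squared sizes, so this is Cauchy–Schwarz. -/
theorem sq_card_freeElements_le {k : ℕ} {A : Finset α} (hA : A ∈ injSets c k) :
    ((freeElements c A).card : ℝ) ^ 2 ≤
      ((Finset.univ.image c).card - k) * ∑ a ∈ freeElements c A, (fiberCard c a : ℝ) := by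
  obtain ⟨hk, hinj⟩ := mem_injSets.1 hA
  set T := Finset.univ.image c \ A.image c with hT
  have hTc : (T.card : ℝ) = (Finset.univ.image c).card - k := by
    rw [hT, Finset.card_sdiff_of_subset (Finset.image_subset_image (Finset.subset_univ _)),
      Nat.cast_sub (Finset.card_le_card (Finset.image_subset_image (Finset.subset_univ _))),
      Finset.card_image_of_injOn hinj, hk]
  have hmaps : ∀ a ∈ freeElements c A, c a ∈ T := by
    intro a ha
    simp only [hT, Finset.mem_sdiff, Finset.mem_image_of_mem c (Finset.mem_univ a), true_and]
    exact (Finset.mem_filter.1 ha).2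
  have hfib : ∀ b ∈ T, (freeElements c A).filter (fun a => c a = b) =
      Finset.univ.filter fun a => c a = b := by
    intro b hb
    ext a
    simp only [freeElements, Finset.mem_filter, Finset.mem_univ, true_and, and_iff_right_iff_imp]
    rintro rfl
    exact (Finset.mem_sdiff.1 hb).2
  rw [← hTc, Finset.card_eq_sum_card_fiberwise hmaps, ← Finset.sum_fiberwise_of_maps_to hmaps,
    Nat.cast_sum]
  refine sq_sum_le_card_mul_sum_sq.trans (le_of_eq ?_)
  congr 1
  refine Finset.sum_congr rfl fun b hb => ?_
  rw [hfib b hb, Finset.sum_congr rfl (g := fun _ =>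
    ((Finset.univ.filter fun a => c a = b).card : ℝ))]
  · rw [Finset.sum_const, nsmul_eq_mul, sq]
  · intro a ha
    rw [fiberCard, (Finset.mem_filter.1 ha).2]

theorem succ_mul_card_injSets_succ [DecidableEq α] (k : ℕ) :
    ((k : ℝ) + 1) * (injSets c (k + 1)).card =
      ∑ A ∈ injSets c k, ((freeElements c A).card : ℝ) := by
  have h := sum_injSets_succ (c := c) (k := k) fun _ _ => 1
  simp only [Finset.sum_const, nsmul_eq_mul, mul_one] at h
  rw [← h, Finset.sum_congr rfl fun A hA => by rw [(mem_injSets.1 hA).1]]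
  rw [Finset.sum_const, nsmul_eq_mul, mul_comm]
  push_cast
  rfl

/-- A form of Maclaurin's inequality for elementary symmetric functions. -/
theorem card_injSets_succ_le [DecidableEq α] (k : ℕ) :
    ((Finset.univ.image c).card : ℝ) * (k + 2) * (injSets c (k + 2)).card ≤
      ((Finset.univ.image c).card - (k + 1)) * Fintype.card α * (injSets c (k + 1)).card := by
  set M : ℝ := ((Finset.univ.image c).card : ℝ)
  set N : ℝ := (Fintype.card α : ℝ)
  set W : ℝ := ∑ A ∈ injSets c k, ∑ a ∈ freeElements c A, (fiberCard c a : ℝ)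
  set Q : ℝ := ∑ A ∈ injSets c k, ((freeElements c A).card : ℝ) ^ 2
  have h1 := succ_mul_card_injSets_succ (c := c) (k + 1)
  push_cast at h1
  have hW : W = N * (injSets c (k + 1)).card -
      ∑ A ∈ injSets c (k + 1), ((freeElements c A).card : ℝ) := by
    have := sum_injSets_succ (c := c) (k := k) fun _ a => (fiberCard c a : ℝ)
    rw [show W = _ from this.symm,
      Finset.sum_congr rfl fun A hA => sum_fiberCard (mem_injSets.1 hA).2]
    simp [N, mul_comm]
  have hQ : ((k : ℝ) + 1) * ∑ A ∈ injSets c (k + 1), ((freeElements c A).card : ℝ) = Q - W := by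
    have := sum_injSets_succ (c := c) (k := k) fun A _ => ((freeElements c A).card : ℝ)
    rw [Finset.mul_sum]
    simp only [Finset.sum_const, nsmul_eq_mul] at this
    rw [Finset.sum_congr rfl (g := fun A : Finset α => (A.card : ℝ) * (freeElements c A).card)
      fun A hA => by rw [(mem_injSets.1 hA).1]; push_cast; rfl, this]
    simp only [Q, W, ← Finset.sum_sub_distrib]
    refine Finset.sum_congr rfl fun A _ => ?_
    rw [Finset.sum_congr rfl fun a ha => card_freeElements_insert ha]
    simp [sq]
  have hCS : Q ≤ (M - k) * W := by
    simp only [Q, W, Finset.mul_sum (injSets c k)]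
    exact Finset.sum_le_sum fun A hA => sq_card_freeElements_le hA
  have hgoal : M * (k + 2) * (injSets c (k + 2)).card =
      M * ∑ A ∈ injSets c (k + 1), ((freeElements c A).card : ℝ) := by
    rw [← h1]
    ring
  -- Let `S` be the sum of `|freeElements c A|` over `injSets c (k + 1)`, and `I` the cardinality of
  -- that family. Then `(k+1)S = Q - W ≤ (M-k-1)W = (M-k-1)(N I - S)`; collecting the terms in `S`
  -- gives `M S ≤ (M-k-1) N I`.
  have hQ' := sub_le_sub_right hCS W
  rw [← hQ, hW] at hQ'
  rw [hgoal]
  linarith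

theorem card_injSets_le_choose (k : ℕ) :
    ((injSets c k).card : ℝ) ≤ (Fintype.card α).choose k := by
  have : (injSets c k).card ≤ (Finset.powersetCard k (Finset.univ : Finset α)).card :=
    Finset.card_filter_le _ _
  rw [Finset.card_powersetCard, Finset.card_univ] at this
  exact_mod_cast this

/-- Going from `j` to `j + 1` elements multiplies the proportion of injective sets by at most `(1 -
j/M)/(1 - j/N)`. For `j < M` and `N ≥ 2M` this is at most `1 - j/(2M) ≤ exp(-j/(2M))`; the exponents
for `j < k` add up to `k(k-1)/(4M)`. -/
theorem card_injSets_le [DecidableEq α] (hM : 0 < (Finset.univ.image c).card)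
    (hMN : 2 * (Finset.univ.image c).card ≤ Fintype.card α) (k : ℕ) :
    ((injSets c k).card : ℝ) ≤ Real.exp (-(k * (k - 1) / (4 * (Finset.univ.image c).card))) *
      (Fintype.card α).choose k := by
  match k with
  | 0 => simpa using card_injSets_le_choose (c := c) 0
  | 1 => simpa using card_injSets_le_choose (c := c) 1
  | k + 2 =>
    have ih := card_injSets_le hM hMN (k + 1)
    have step := card_injSets_succ_le (c := c) k
    set M := (Finset.univ.image c).card
    set N := Fintype.card α
    have hM' : (0 : ℝ) < M := by exact_mod_cast hM
    have hMN' : 2 * (M : ℝ) ≤ N := by exact_mod_cast hMN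
    have hg0 : (0 : ℝ) ≤ (injSets c (k + 1)).card := Nat.cast_nonneg _
    -- With at most `k + 1` classes, no set of `k + 2` elements is injective.
    rcases le_or_gt M (k + 1) with hk | hk
    · have hk' : (M : ℝ) ≤ k + 1 := by exact_mod_cast hk
      have h0 : (M : ℝ) * (k + 2) * (injSets c (k + 2)).card ≤ 0 := by
        refine step.trans ?_
        have : 0 ≤ (k + 1 - (M : ℝ)) * N * (injSets c (k + 1)).card := by
          have : 0 ≤ k + 1 - (M : ℝ) := by linarith
          positivity
        linarith
      have : ((injSets c (k + 2)).card : ℝ) ≤ 0 := by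
        by_contra! hlt
        have : 0 < (M : ℝ) * (k + 2) * (injSets c (k + 2)).card := by positivity
        linarith
      exact this.trans (by positivity)
    · have hk' : (k : ℝ) + 1 < M := by exact_mod_cast hk
      have hch : (N.choose (k + 2) : ℝ) * (k + 2) = N.choose (k + 1) * (N - (k + 1)) := by
        have := Nat.choose_succ_right_eq N (k + 1)
        have h' : ((N - (k + 1) : ℕ) : ℝ) = N - (k + 1) := by
          rw [Nat.cast_sub (by omega)]
          push_cast
          ring
        rw [← h']
        exact_mod_cast this
      set e := Real.exp (-(((k + 1 : ℕ) : ℝ) * ((k + 1 : ℕ) - 1) / (4 * M)))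
      have he : Real.exp (-(((k + 2 : ℕ) : ℝ) * ((k + 2 : ℕ) - 1) / (4 * M))) =
          Real.exp (-((k + 1) / (2 * M))) * e := by
        rw [← Real.exp_add]
        congr 1
        push_cast
        field_simp
        ring
      have hexp : 1 - ((k : ℝ) + 1) / (2 * M) ≤ Real.exp (-((k + 1) / (2 * M))) := by
        have := Real.add_one_le_exp (-(((k : ℝ) + 1) / (2 * M)))
        linarith
      have hpoly : ((M : ℝ) - (k + 1)) * N ≤
          M * (1 - ((k : ℝ) + 1) / (2 * M)) * (N - (k + 1)) := by
        have : (M : ℝ) * (1 - ((k : ℝ) + 1) / (2 * M)) = M - (k + 1) / 2 := by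
          field_simp
        rw [this]
        nlinarith
      rw [he]
      have hpos : (0 : ℝ) < M * (k + 2) := by positivity
      refine le_of_mul_le_mul_left ?_ hpos
      have hN : (0 : ℝ) ≤ N - (k + 1) := by linarith
      have hM1 : (0 : ℝ) ≤ M - (k + 1) := by linarith
      have he0 : 0 ≤ e := (Real.exp_pos _).le
      calc (M : ℝ) * (k + 2) * (injSets c (k + 2)).card
          ≤ (M - (k + 1)) * N * (injSets c (k + 1)).card := step
        _ ≤ (M - (k + 1)) * N * (e * N.choose (k + 1)) := by gcongr
        _ ≤ M * (1 - ((k : ℝ) + 1) / (2 * M)) * (N - (k + 1)) * (e * N.choose (k + 1)) := by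
          gcongr
        _ ≤ M * Real.exp (-((k + 1) / (2 * M))) * (N - (k + 1)) * (e * N.choose (k + 1)) := by
          gcongr
        _ = M * Real.exp (-((k + 1) / (2 * M))) * e * (N.choose (k + 1) * (N - (k + 1))) := by
          ring
        _ = M * (k + 2) * (Real.exp (-((k + 1) / (2 * M))) * e * N.choose (k + 2)) := by
          rw [← hch]
          ring

end Birthday

/-! ### Common cyclic subwords -/

/-- The position, in a word of length `n`, of the letter that gives rise to the letter number `j`
of the cyclic subwords starting at position `i` of the word (if `ε = true`) or of its inverse. -/
def cyclicPos (n : ℕ) (ε : Bool) (i j : ℕ) : ℕ :=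
  bif ε then (j + i) % n else n - 1 - (j + i) % n

theorem cyclicPos_lt {n : ℕ} (hn : 0 < n) (ε : Bool) (i j : ℕ) : cyclicPos n ε i j < n := by
  have := Nat.mod_lt (j + i) hn
  cases ε <;> simp [cyclicPos] <;> omega

theorem mod_eq_of_cyclicPos_eq {n : ℕ} (hn : 0 < n) {ε : Bool} {i i' j j' : ℕ}
    (h : cyclicPos n ε i j = cyclicPos n ε i' j') : (j + i) % n = (j' + i') % n := by
  have := Nat.mod_lt (j + i) hn
  have := Nat.mod_lt (j' + i') hn
  cases ε <;> simp [cyclicPos] at h <;> omega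

theorem cyclicPos_injOn {n L : ℕ} (hL : L ≤ n) (ε : Bool) (i : ℕ) :
    Set.InjOn (cyclicPos n ε i) (Finset.range L) := by
  intro j hj j' hj' h
  simp only [Finset.coe_range, Set.mem_Iio] at hj hj'
  have h1 : j ≡ j' [MOD n] :=
    Nat.ModEq.add_right_cancel' i (mod_eq_of_cyclicPos_eq (by omega) h)
  exact Nat.ModEq.eq_of_lt_of_lt h1 (by omega) (by omega)

theorem cyclicPos_left_injective {n : ℕ} {ε : Bool} {i i' j : ℕ} (hi : i < n) (hi' : i' < n)
    (h : cyclicPos n ε i j = cyclicPos n ε i' j) : i = i' := by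
  have h1 : i ≡ i' [MOD n] :=
    Nat.ModEq.add_left_cancel' j (mod_eq_of_cyclicPos_eq (by omega) h)
  exact Nat.ModEq.eq_of_lt_of_lt h1 hi hi'

theorem length_orient {m : ℕ} (r : Word m) (ε : Bool) : (orient r ε).length = r.length := by
  cases ε <;> simp [orient]

theorem getElem?_rotate_orient {m : ℕ} (r : Word m) (ε : Bool) (i : ℕ) {j : ℕ}
    (hj : j < r.length) :
    ((orient r ε).rotate i)[j]? = (r[cyclicPos r.length ε i j]?).map (orientLetter ε) := by
  have hlt := Nat.mod_lt (j + i) (show 0 < r.length by omega)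
  rw [List.getElem?_rotate (by rwa [length_orient]), length_orient]
  cases ε
  · simp only [orient, cyclicPos, cond_false, FreeGroup.invRev]
    rw [List.getElem?_reverse (by simpa using hlt), List.getElem?_map, List.length_map]
    rfl
  · have : (orientLetter true : Fin m × Bool → Fin m × Bool) = id := rfl
    simp [orient, cyclicPos, this]

/-- The cyclic subwords of length `L` of `r^±` and `r'^±` at the positions `i` and `i'` agree. -/
def CommonSubword {m : ℕ} (L : ℕ) (r r' : Word m) (ε ε' : Bool) (i i' : ℕ) : Prop :=
  L ≤ r.length ∧ L ≤ r'.length ∧ i < r.length ∧ i' < r'.length ∧ ∀ j < L,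
    (r[cyclicPos r.length ε i j]?).map (orientLetter ε) =
      (r'[cyclicPos r'.length ε' i' j]?).map (orientLetter ε')

theorem commonSubword_of_occursAt {m : ℕ} {w r r' : Word m} {ε ε' : Bool} {i i' L : ℕ}
    (h : OccursAt w r ε i) (h' : OccursAt w r' ε' i') (hL : L ≤ w.length) :
    CommonSubword L r r' ε ε' i i' := by
  have hw := h.2.length_le
  have hw' := h'.2.length_le
  rw [List.length_rotate, length_orient] at hw hw'
  refine ⟨by omega, by omega, h.1, h'.1, fun j hj => ?_⟩
  rw [← getElem?_rotate_orient r ε i (by omega), ← getElem?_rotate_orient r' ε' i' (by omega)]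
  obtain ⟨t, ht⟩ := h.2
  obtain ⟨t', ht'⟩ := h'.2
  rw [← ht, ← ht', List.getElem?_append_left (by omega), List.getElem?_append_left (by omega)]

/-- The relator `r` for which the piece is too long need not be one of the two relators witnessing
that it is a piece. Its occurrence in `r` still differs from at least one of these two occurrences.
-/
theorem exists_commonSubword_of_not_smallCancellation {m : ℕ} {lam : ℝ} (hlam : 0 ≤ lam)
    {S : Set (Word m)} (h : ¬ SmallCancellation lam S) :
    ∃ r ∈ S, ∃ r' ∈ S, ∃ ε ε' i i', (r, ε, i) ≠ (r', ε', i') ∧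
      CommonSubword (⌊lam * r.length⌋₊ + 1) r r' ε ε' i i' := by
  simp only [SmallCancellation, not_forall, not_le] at h
  obtain ⟨w, ⟨r₁, h₁, r₂, h₂, ε₁, ε₂, i₁, i₂, o₁, o₂, hne⟩, r, hr, ⟨ε, i, o⟩, hw⟩ := h
  have hL : ⌊lam * r.length⌋₊ + 1 ≤ w.length := (Nat.floor_lt (by positivity)).2 hw
  by_cases h : (r, ε, i) = (r₁, ε₁, i₁)
  · exact ⟨r, hr, r₂, h₂, ε, ε₂, i, i₂, h ▸ hne, commonSubword_of_occursAt o o₂ hL⟩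
  · exact ⟨r, hr, r₁, h₁, ε, ε₁, i, i₁, h, commonSubword_of_occursAt o o₁ hL⟩

theorem orientLetter_injective {m : ℕ} (ε : Bool) :
    Function.Injective (orientLetter ε : Fin m × Bool → Fin m × Bool) :=
  Function.LeftInverse.injective (orientLetter_orientLetter ε)

-- Once `r` is fixed, the `L` letters of `r'` covered by the common subword are all determined.
open Classical in
theorem card_commonSubword_right_le {m : ℕ} (hm : 1 ≤ m) (L : ℕ) (r : Word m) (n : ℕ)
    (ε ε' : Bool) (i i' : ℕ) :
    ((reducedWords m n).filter fun r' => CommonSubword L r r' ε ε' i i').card ≤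
      2 * m * (2 * m - 1) ^ (n - L) := by
  set S := (reducedWords m n).filter fun r' => CommonSubword L r r' ε ε' i i' with hS
  rcases S.eq_empty_or_nonempty with h0 | ⟨s, hs⟩
  · simp [h0]
  obtain ⟨hs, -, hLn, -, hi', -⟩ := Finset.mem_filter.1 hs
  rw [(mem_reducedWords.1 hs).1] at hLn hi'
  have hn : 0 < n := by omega
  have hc : ((Finset.range L).image (cyclicPos n ε' i')).card = L := by
    rw [Finset.card_image_of_injOn (cyclicPos_injOn hLn ε' i'), Finset.card_range]
  have := card_le_of_determined n ((Finset.range L).image (cyclicPos n ε' i'))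
    (by
      intro p hp
      obtain ⟨j, -, rfl⟩ := Finset.mem_image.1 hp
      exact Finset.mem_range.2 (cyclicPos_lt hn ε' i' j)) S
    (fun w hw => (mem_reducedWords.1 (Finset.mem_filter.1 hw).1).1)
    (fun w hw => (mem_reducedWords.1 (Finset.mem_filter.1 hw).1).2)
    (by
      intro u hu v hv p hp _
      obtain ⟨j, hj, rfl⟩ := Finset.mem_image.1 hp
      obtain ⟨hu, -, -, -, -, hu'⟩ := Finset.mem_filter.1 hu
      obtain ⟨hv, -, -, -, -, hv'⟩ := Finset.mem_filter.1 hv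
      have e := (hu' j (Finset.mem_range.1 hj)).symm.trans (hv' j (Finset.mem_range.1 hj))
      rw [(mem_reducedWords.1 hu).1, (mem_reducedWords.1 hv).1] at e
      exact Option.map_injective (orientLetter_injective ε') e) hm
  rwa [hc] at this

-- The two occurrences may overlap, so each coincidence is used to determine the later of two
-- positions from the earlier one. A position is the later one for at most two indices `j`, so at
-- least `⌈L/2⌉` letters are determined.
open Classical in
theorem card_commonSubword_self_le {m : ℕ} (hm : 1 ≤ m) (L n : ℕ)
    (ε ε' : Bool) (i i' : ℕ) (hne : (ε, i) ≠ (ε', i')) :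
    ((reducedWords m n).filter fun r => CommonSubword L r r ε ε' i i').card ≤
      2 * m * (2 * m - 1) ^ (n - (L + 1) / 2) := by
  set S := (reducedWords m n).filter fun r => CommonSubword L r r ε ε' i i' with hS
  rcases S.eq_empty_or_nonempty with h0 | ⟨s, hs⟩
  · simp [h0]
  have key : ∀ w ∈ S, w.length = n ∧ FreeGroup.IsReduced w ∧ L ≤ n ∧ i < n ∧ i' < n ∧
      ∀ j < L, (w[cyclicPos n ε i j]?).map (orientLetter ε) =
        (w[cyclicPos n ε' i' j]?).map (orientLetter ε') := by
    intro w hw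
    obtain ⟨h1, h2, -, h3, h4, h5⟩ := Finset.mem_filter.1 hw
    obtain ⟨rfl, h6⟩ := mem_reducedWords.1 h1
    exact ⟨rfl, h6, h2, h3, h4, h5⟩
  obtain ⟨hsn, -, hLn, hi, hi', hs'⟩ := key s hs
  have hn : 0 < n := by omega
  -- With equal orientations the starting positions differ; with opposite ones, a coincidence of
  -- positions would make a letter equal to its own inverse.
  have hpos : ∀ j < L, cyclicPos n ε i j ≠ cyclicPos n ε' i' j := by
    intro j hj e
    by_cases hε : ε = ε'
    · subst hε
      exact hne (by rw [cyclicPos_left_injective hi hi' e])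
    · have h := hs' j hj
      have hlt := cyclicPos_lt hn ε' i' j
      rw [e, List.getElem?_eq_getElem (by omega)] at h
      simp only [Option.map_some, Option.some.injEq] at h
      cases ε <;> cases ε' <;> simp [orientLetter] at h hε
      · exact invLetter_ne _ h
      · exact invLetter_ne _ h.symm
  set f : ℕ → ℕ := fun j => max (cyclicPos n ε i j) (cyclicPos n ε' i' j) with hf
  have hJ : L ≤ 2 * ((Finset.range L).image f).card := by
    have := Finset.card_le_mul_card_image (f := f) (Finset.range L) 2 (by
      intro p _
      have hsub : (Finset.range L).filter (fun j => f j = p) ⊆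
          (Finset.range L).filter (fun j => cyclicPos n ε i j = p) ∪
            (Finset.range L).filter (fun j => cyclicPos n ε' i' j = p) := by
        intro j hj
        simp only [Finset.mem_union, Finset.mem_filter, hf] at hj ⊢
        rcases max_choice (cyclicPos n ε i j) (cyclicPos n ε' i' j) with h | h
        · exact Or.inl ⟨hj.1, h ▸ hj.2⟩
        · exact Or.inr ⟨hj.1, h ▸ hj.2⟩
      have hone : ∀ η k, ((Finset.range L).filter (fun j => cyclicPos n η k j = p)).card ≤ 1 := by
        intro η k
        refine Finset.card_le_one.2 fun a ha b hb => ?_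
        rw [Finset.mem_filter] at ha hb
        exact cyclicPos_injOn hLn η k (Finset.mem_coe.2 ha.1) (Finset.mem_coe.2 hb.1)
          (ha.2.trans hb.2.symm)
      have h1 := hone ε i
      have h2 := hone ε' i'
      exact ((Finset.card_le_card hsub).trans (Finset.card_union_le _ _)).trans (by omega))
    simpa using this
  refine (card_le_of_determined n ((Finset.range L).image f) ?_ S (fun w hw => (key w hw).1)
    (fun w hw => (key w hw).2.1) ?_ hm).trans ?_
  · intro p hp
    obtain ⟨j, -, rfl⟩ := Finset.mem_image.1 hp
    exact Finset.mem_range.2 (max_lt (cyclicPos_lt hn ε i j) (cyclicPos_lt hn ε' i' j))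
  · intro u hu v hv p hp e
    obtain ⟨j, hj, rfl⟩ := Finset.mem_image.1 hp
    have hj := Finset.mem_range.1 hj
    have hu' := (key u hu).2.2.2.2.2 j hj
    have hv' := (key v hv).2.2.2.2.2 j hj
    have ht : ∀ x < f j, u[x]? = v[x]? := by
      intro x hx
      have := congrArg (fun l => l[x]?) e
      simpa only [List.getElem?_take_of_lt hx] using this
    rcases lt_or_gt_of_ne (hpos j hj) with h | h
    · have hfj : f j = cyclicPos n ε' i' j := max_eq_right h.le
      rw [ht _ (h.trans_eq hfj.symm), hv'] at hu'
      rw [hfj]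
      exact Option.map_injective (orientLetter_injective ε') hu'.symm
    · have hfj : f j = cyclicPos n ε i j := max_eq_left h.le
      rw [← ht _ (h.trans_eq hfj.symm), ← hu'] at hv'
      rw [hfj]
      exact Option.map_injective (orientLetter_injective ε) hv'.symm
  · exact Nat.mul_le_mul_left _ (Nat.pow_le_pow_right (by omega) (by omega))

/-! ### Counting the relators with long common subwords -/

open Classical in
/-- The pairs of different relators with a common subword longer than `lam` times the length of
the first one. -/
noncomputable def pairsWithCommonSubword (m ℓ : ℕ) (lam : ℝ) : Finset (B m ℓ × B m ℓ) :=
  Finset.univ.filter fun x => x.1 ≠ x.2 ∧ ∃ ε ε' i i',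
    CommonSubword (⌊lam * x.1.1.length⌋₊ + 1) x.1.1 x.2.1 ε ε' i i'

open Classical in
/-- The relators in which a subword longer than `lam` times their length occurs twice. -/
noncomputable def relatorsWithRepetition (m ℓ : ℕ) (lam : ℝ) : Finset (B m ℓ) :=
  Finset.univ.filter fun x => ∃ ε ε' i i', (ε, i) ≠ (ε', i') ∧
    CommonSubword (⌊lam * x.1.length⌋₊ + 1) x.1 x.1 ε ε' i i'

theorem cast_two_mul_sub_one {m : ℕ} (hm : 1 ≤ m) : ((2 * m - 1 : ℕ) : ℝ) = 2 * m - 1 := by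
  rw [Nat.cast_sub (by omega)]
  push_cast
  ring

theorem pow_le_rpow {m : ℕ} (hm : 1 ≤ m) {n : ℕ} {x : ℝ} (h : (n : ℝ) ≤ x) :
    (((2 * m - 1) ^ n : ℕ) : ℝ) ≤ (2 * m - 1 : ℝ) ^ x := by
  have hm' : (1 : ℝ) ≤ m := by exact_mod_cast hm
  rw [Nat.cast_pow, cast_two_mul_sub_one hm, ← Real.rpow_natCast]
  exact Real.rpow_le_rpow_of_exponent_le (by linarith) h

/-- Union bound over two lengths, two positions and four pairs of orientations. For lengths `n, n'`
the exponent is `n + n' - L ≤ (1 - λ)n + n' ≤ (2 - λ)ℓ`, where `λ ≤ 1` allows the replacement of `n`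
by `ℓ`. -/
theorem card_pairsWithCommonSubword_le {m : ℕ} (hm : 1 ≤ m) (ℓ : ℕ) {lam : ℝ}
    (h1 : lam ≤ 1) :
    ((pairsWithCommonSubword m ℓ lam).card : ℝ) ≤
      4 * (ℓ + 1) ^ 4 * ((2 * m) ^ 2 * (2 * m - 1 : ℝ) ^ ((2 - lam) * ℓ)) := by
  classical
  let I := (Finset.range (ℓ + 1) ×ˢ Finset.range (ℓ + 1)) ×ˢ
    (Finset.univ : Finset (Bool × Bool)) ×ˢ (Finset.range (ℓ + 1) ×ˢ Finset.range (ℓ + 1))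
  let U : (ℕ × ℕ) × (Bool × Bool) × (ℕ × ℕ) → Finset (Word m × Word m) := fun x =>
    (reducedWords m x.1.1 ×ˢ reducedWords m x.1.2).filter fun y =>
      CommonSubword (⌊lam * x.1.1⌋₊ + 1) y.1 y.2 x.2.1.1 x.2.1.2 x.2.2.1 x.2.2.2
  have hIc : (I.card : ℝ) = 4 * (ℓ + 1) ^ 4 := by
    simp only [I, Finset.card_product, Finset.card_range, Finset.card_univ, Fintype.card_prod,
      Fintype.card_bool]
    push_cast
    ring
  have hU : ∀ x ∈ I, ((U x).card : ℝ) ≤ (2 * m) ^ 2 * (2 * m - 1 : ℝ) ^ ((2 - lam) * ℓ) := by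
    rintro ⟨⟨n, n'⟩, ⟨ε, ε'⟩, i, i'⟩ hx
    simp only [I, Finset.mem_product, Finset.mem_range] at hx
    have hpos : (0 : ℝ) ≤ (2 * m - 1 : ℝ) ^ ((2 - lam) * ℓ) := by
      have : (1 : ℝ) ≤ m := by exact_mod_cast hm
      exact Real.rpow_nonneg (by linarith) _
    rcases (U ((n, n'), (ε, ε'), i, i')).eq_empty_or_nonempty with he | ⟨y, hy⟩
    · rw [he, Finset.card_empty, Nat.cast_zero]
      positivity
    set L := ⌊lam * n⌋₊ + 1 with hL
    have hLn' : L ≤ n' := by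
      obtain ⟨hy, -, h, -⟩ := Finset.mem_filter.1 hy
      rwa [(mem_reducedWords.1 (Finset.mem_product.1 hy).2).1] at h
    have hLlam : lam * n ≤ L := by
      rw [hL]
      push_cast
      exact (Nat.lt_floor_add_one _).le
    have hc := Finset.card_le_mul_card_image_of_maps_to (f := Prod.fst)
      (s := U ((n, n'), (ε, ε'), i, i')) (t := reducedWords m n)
      (fun y hy => (Finset.mem_product.1 (Finset.mem_filter.1 hy).1).1)
      (2 * m * (2 * m - 1) ^ (n' - L)) (by
        intro r hr
        refine le_trans ?_ (card_commonSubword_right_le hm L r n' ε ε' i i')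
        refine Finset.card_le_card_of_injOn Prod.snd ?_ ?_
        · rintro ⟨a, b⟩ hy
          simp only [Finset.coe_filter, Finset.mem_filter, Finset.mem_product, U,
            Set.mem_ofPred_eq] at hy ⊢
          obtain ⟨⟨⟨-, hb⟩, hab⟩, rfl⟩ := hy
          exact ⟨hb, hab⟩
        · rintro ⟨a, b⟩ hy ⟨a', b'⟩ hy' h
          simp only [Finset.coe_filter, Set.mem_ofPred_eq] at hy hy'
          exact Prod.ext (hy.2.trans hy'.2.symm) h)
    have hc2 := hc.trans (Nat.mul_le_mul_left _ (card_reducedWords_le hm n))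
    have e : 2 * m * (2 * m - 1) ^ (n' - L) * (2 * m * (2 * m - 1) ^ n) =
        (2 * m) ^ 2 * (2 * m - 1) ^ (n + (n' - L)) := by
      rw [pow_add]
      ring
    rw [e] at hc2
    have hc3 : ((U ((n, n'), (ε, ε'), i, i')).card : ℝ) ≤
        (2 * m) ^ 2 * (((2 * m - 1) ^ (n + (n' - L)) : ℕ) : ℝ) := by exact_mod_cast hc2
    refine hc3.trans (mul_le_mul_of_nonneg_left (pow_le_rpow hm ?_) (by positivity))
    rw [Nat.cast_add, Nat.cast_sub hLn']
    have hn : (n : ℝ) ≤ ℓ := by exact_mod_cast (show n ≤ ℓ by omega)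
    have hn' : (n' : ℝ) ≤ ℓ := by exact_mod_cast (show n' ≤ ℓ by omega)
    nlinarith
  have hsub : (pairsWithCommonSubword m ℓ lam).card ≤ (I.biUnion U).card := by
    refine Finset.card_le_card_of_injOn (fun x => (x.1.1, x.2.1)) ?_ ?_
    · rintro ⟨⟨r, hr⟩, ⟨r', hr'⟩⟩ hx
      simp only [pairsWithCommonSubword, Finset.coe_filter, Set.mem_ofPred_eq] at hx
      obtain ⟨-, -, ε, ε', i, i', h⟩ := hx
      have hr := mem_B.1 hr
      have hr' := mem_B.1 hr'
      refine Finset.mem_coe.2 (Finset.mem_biUnion.2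
        ⟨((r.length, r'.length), (ε, ε'), i, i'), ?_, ?_⟩)
      · have h3 := h.2.2.1
        have h4 := h.2.2.2.1
        simp only [I, Finset.mem_product, Finset.mem_range, Finset.mem_univ]
        exact ⟨⟨by omega, by omega⟩, trivial, by omega, by omega⟩
      · simp only [U, Finset.mem_filter, Finset.mem_product, mem_reducedWords]
        exact ⟨⟨⟨trivial, hr.1.1⟩, ⟨trivial, hr'.1.1⟩⟩, h⟩
    · rintro ⟨x, x'⟩ _ ⟨y, y'⟩ _ h
      simp only [Prod.mk.injEq] at h
      exact Prod.ext (Subtype.ext h.1) (Subtype.ext h.2)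
  have h2 : ((I.biUnion U).card : ℝ) ≤ ∑ x ∈ I, ((U x).card : ℝ) := by
    exact_mod_cast Finset.card_biUnion_le
  calc _ ≤ ((I.biUnion U).card : ℝ) := by exact_mod_cast hsub
    _ ≤ ∑ x ∈ I, ((U x).card : ℝ) := h2
    _ ≤ _ := Finset.sum_le_sum hU
    _ = _ := by rw [Finset.sum_const, nsmul_eq_mul, hIc]

/-- Same union bound with a single length; half of the `L ≥ λn` repeated letters are saved, leaving
the exponent `(1 - λ/2)n`. -/
theorem card_relatorsWithRepetition_le {m : ℕ} (hm : 1 ≤ m) (ℓ : ℕ) {lam : ℝ}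
    (h1 : lam ≤ 1) :
    ((relatorsWithRepetition m ℓ lam).card : ℝ) ≤
      4 * (ℓ + 1) ^ 3 * ((2 * m) * (2 * m - 1 : ℝ) ^ ((1 - lam / 2) * ℓ)) := by
  classical
  let I := (Finset.range (ℓ + 1) ×ˢ
    (Finset.univ : Finset (Bool × Bool)) ×ˢ
      (Finset.range (ℓ + 1) ×ˢ Finset.range (ℓ + 1))).filter fun x =>
        (x.2.1.1, x.2.2.1) ≠ (x.2.1.2, x.2.2.2)
  let U : ℕ × (Bool × Bool) × (ℕ × ℕ) → Finset (Word m) := fun x =>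
    (reducedWords m x.1).filter fun y =>
      CommonSubword (⌊lam * x.1⌋₊ + 1) y y x.2.1.1 x.2.1.2 x.2.2.1 x.2.2.2
  have hIc : (I.card : ℝ) ≤ 4 * (ℓ + 1) ^ 3 := by
    have h := Finset.card_filter_le (Finset.range (ℓ + 1) ×ˢ
      (Finset.univ : Finset (Bool × Bool)) ×ˢ (Finset.range (ℓ + 1) ×ˢ Finset.range (ℓ + 1)))
      fun x => (x.2.1.1, x.2.2.1) ≠ (x.2.1.2, x.2.2.2)
    simp only [Finset.card_product, Finset.card_range, Finset.card_univ, Fintype.card_prod,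
      Fintype.card_bool] at h
    have h' : (I.card : ℝ) ≤ (((ℓ + 1) * (2 * 2 * ((ℓ + 1) * (ℓ + 1))) : ℕ) : ℝ) := by
      exact_mod_cast h
    refine h'.trans (le_of_eq ?_)
    push_cast
    ring
  have hm' : (1 : ℝ) ≤ m := by exact_mod_cast hm
  have hpos : (0 : ℝ) ≤ (2 * m - 1 : ℝ) ^ ((1 - lam / 2) * ℓ) :=
    Real.rpow_nonneg (by linarith) _
  have hU : ∀ x ∈ I, ((U x).card : ℝ) ≤ (2 * m) * (2 * m - 1 : ℝ) ^ ((1 - lam / 2) * ℓ) := by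
    rintro ⟨n, ⟨ε, ε'⟩, i, i'⟩ hx
    simp only [I, Finset.mem_filter, Finset.mem_product, Finset.mem_range] at hx
    rcases (U (n, (ε, ε'), i, i')).eq_empty_or_nonempty with he | ⟨y, hy⟩
    · rw [he, Finset.card_empty, Nat.cast_zero]
      positivity
    have hc := card_commonSubword_self_le hm (⌊lam * n⌋₊ + 1) n ε ε' i i' hx.2
    set L := ⌊lam * n⌋₊ + 1 with hL
    have hLn : L ≤ n := by
      obtain ⟨hy, h, -⟩ := Finset.mem_filter.1 hy
      rwa [(mem_reducedWords.1 hy).1] at h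
    have hLlam : lam * n ≤ L := by
      rw [hL]
      push_cast
      exact (Nat.lt_floor_add_one _).le
    have hc3 : ((U (n, (ε, ε'), i, i')).card : ℝ) ≤
        (2 * m) * (((2 * m - 1) ^ (n - (L + 1) / 2) : ℕ) : ℝ) := by exact_mod_cast hc
    refine hc3.trans (mul_le_mul_of_nonneg_left (pow_le_rpow hm ?_) (by positivity))
    rw [Nat.cast_sub (by omega)]
    have hn : (n : ℝ) ≤ ℓ := by exact_mod_cast (show n ≤ ℓ by omega)
    have hhalf : (L : ℝ) ≤ 2 * ((L + 1) / 2 : ℕ) := by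
      exact_mod_cast (show L ≤ 2 * ((L + 1) / 2) by omega)
    nlinarith
  have hsub : (relatorsWithRepetition m ℓ lam).card ≤ (I.biUnion U).card := by
    refine Finset.card_le_card_of_injOn Subtype.val ?_ Subtype.val_injective.injOn
    rintro ⟨r, hr⟩ hx
    simp only [relatorsWithRepetition, Finset.coe_filter, Set.mem_ofPred_eq] at hx
    obtain ⟨-, ε, ε', i, i', hne, h⟩ := hx
    have hr := mem_B.1 hr
    refine Finset.mem_coe.2 (Finset.mem_biUnion.2 ⟨(r.length, (ε, ε'), i, i'), ?_, ?_⟩)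
    · have h3 := h.2.2.1
      have h4 := h.2.2.2.1
      simp only [I, Finset.mem_filter, Finset.mem_product, Finset.mem_range, Finset.mem_univ]
      exact ⟨⟨by omega, trivial, by omega, by omega⟩, hne⟩
    · simp only [U, Finset.mem_filter, mem_reducedWords]
      exact ⟨⟨trivial, hr.1.1⟩, h⟩
  have h2 : ((I.biUnion U).card : ℝ) ≤ ∑ x ∈ I, ((U x).card : ℝ) := by
    exact_mod_cast Finset.card_biUnion_le
  calc _ ≤ ((I.biUnion U).card : ℝ) := by exact_mod_cast hsub
    _ ≤ ∑ x ∈ I, ((U x).card : ℝ) := h2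
    _ ≤ _ := Finset.sum_le_sum hU
    _ = I.card * ((2 * m) * (2 * m - 1 : ℝ) ^ ((1 - lam / 2) * ℓ)) := by
      rw [Finset.sum_const, nsmul_eq_mul]
    _ ≤ _ := by gcongr

open Classical in
/-- The proportion of the sets of `k` relators that do not satisfy `C'(lam)`. -/
theorem card_not_smallCancellation_le {m ℓ : ℕ} {lam : ℝ} (h0 : 0 ≤ lam) (k : ℕ) :
    (((Finset.powersetCard k Finset.univ).filter fun A : Finset (B m ℓ) =>
      ¬ SmallCancellation lam (relators A)).card : ℝ) ≤
      ((pairsWithCommonSubword m ℓ lam).card * (k / (B m ℓ).card : ℝ) ^ 2 +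
        (relatorsWithRepetition m ℓ lam).card * (k / (B m ℓ).card : ℝ)) *
        (B m ℓ).card.choose k := by
  set T := pairsWithCommonSubword m ℓ lam with hT
  set S := relatorsWithRepetition m ℓ lam with hS
  let p : Finset (Finset (B m ℓ)) := Finset.powersetCard k Finset.univ
  have hsub : (p.filter fun A : Finset (B m ℓ) => ¬ SmallCancellation lam (relators A)) ⊆
      (T.biUnion fun x => p.filter fun A => x.1 ∈ A ∧ x.2 ∈ A) ∪
        S.biUnion fun x => p.filter fun A => x ∈ A := by
    intro A hA
    obtain ⟨hAp, hA⟩ := Finset.mem_filter.1 hA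
    obtain ⟨_, ⟨r, hr, rfl⟩, _, ⟨r', hr', rfl⟩, ε, ε', i, i', hne, h⟩ :=
      exists_commonSubword_of_not_smallCancellation h0 hA
    simp only [Finset.mem_union, Finset.mem_biUnion, Finset.mem_filter]
    by_cases e : r = r'
    · subst e
      refine Or.inr ⟨r, ?_, hAp, hr⟩
      simp only [hS, relatorsWithRepetition, Finset.mem_filter, Finset.mem_univ, true_and]
      exact ⟨ε, ε', i, i', fun h => hne (by rw [h]), h⟩
    · refine Or.inl ⟨(r, r'), ?_, hAp, hr, hr'⟩
      simp only [hT, pairsWithCommonSubword, Finset.mem_filter, Finset.mem_univ, true_and]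
      exact ⟨e, ε, ε', i, i', h⟩
  have h1 : (((T.biUnion fun x => p.filter fun A => x.1 ∈ A ∧ x.2 ∈ A).card : ℕ) : ℝ) ≤
      T.card * ((k / (B m ℓ).card : ℝ) ^ 2 * (B m ℓ).card.choose k) := by
    rw [← nsmul_eq_mul, ← Finset.sum_const]
    refine le_trans (by exact_mod_cast Finset.card_biUnion_le)
      (Finset.sum_le_sum (f := fun x : B m ℓ × B m ℓ =>
        (((p.filter fun A => x.1 ∈ A ∧ x.2 ∈ A).card : ℕ) : ℝ)) fun x hx => ?_)
    have := card_pair_mem_le (Finset.mem_filter.1 hx).2.1 k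
    rwa [Fintype.card_coe] at this
  have h2 : (((S.biUnion fun x => p.filter fun A => x ∈ A).card : ℕ) : ℝ) ≤
      S.card * ((k / (B m ℓ).card : ℝ) * (B m ℓ).card.choose k) := by
    rw [← nsmul_eq_mul, ← Finset.sum_const]
    refine le_trans (by exact_mod_cast Finset.card_biUnion_le)
      (Finset.sum_le_sum (f := fun x : B m ℓ =>
        (((p.filter fun A => x ∈ A).card : ℕ) : ℝ)) fun x hx => ?_)
    have := card_mem_le x k
    rwa [Fintype.card_coe] at this
  have h3 : ((p.filter fun A : Finset (B m ℓ) =>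
      ¬ SmallCancellation lam (relators A)).card : ℝ) ≤
      ((T.biUnion fun x => p.filter fun A => x.1 ∈ A ∧ x.2 ∈ A).card : ℝ) +
        ((S.biUnion fun x => p.filter fun A => x ∈ A).card : ℝ) := by
    exact_mod_cast (Finset.card_le_card hsub).trans (Finset.card_union_le _ _)
  linarith

/-! ### Prefixes -/

/-- Relators shorter than `L` are their own prefixes, so every length from `0` to `L` may occur;
hence the factor `L + 1`. -/
theorem card_image_take_le {m : ℕ} (hm : 1 ≤ m) (ℓ L : ℕ) :
    (Finset.univ.image fun x : B m ℓ => x.1.take L).card ≤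
      (L + 1) * (2 * m * (2 * m - 1) ^ L) := by
  classical
  have hsub : (Finset.univ.image fun x : B m ℓ => x.1.take L) ⊆
      (Finset.range (L + 1)).biUnion (reducedWords m) := by
    intro w hw
    obtain ⟨⟨r, hr⟩, -, rfl⟩ := Finset.mem_image.1 hw
    refine Finset.mem_biUnion.2 ⟨_, ?_, mem_reducedWords.2
      ⟨rfl, isReduced_take (mem_B.1 hr).1.1 L⟩⟩
    simp only [List.length_take, Finset.mem_range]
    omega
  refine (Finset.card_le_card hsub).trans ?_
  refine (Finset.card_biUnion_le_card_mul (Finset.range (L + 1)) (reducedWords m)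
    (2 * m * (2 * m - 1) ^ L) fun n hn => ?_).trans_eq (by rw [Finset.card_range])
  refine (card_reducedWords_le hm n).trans (Nat.mul_le_mul_left _ ?_)
  exact Nat.pow_le_pow_right (by omega) (by have := Finset.mem_range.1 hn; omega)

/-- A prefix of length `L` shared by two different relators would be a piece longer than `λℓ`.
Relators shorter than `L` cannot collide, since truncation leaves them unchanged. -/
theorem injOn_take_of_smallCancellation {m ℓ L : ℕ} {lam : ℝ} (hlam : 0 ≤ lam)
    (hL : lam * ℓ < L) {A : Finset (B m ℓ)} (hA : SmallCancellation lam (relators A)) :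
    Set.InjOn (fun x : B m ℓ => x.1.take L) A := by
  rintro ⟨r, hr⟩ hrA ⟨r', hr'⟩ hrA' h
  simp only at h
  by_contra hne
  have hne' : r ≠ r' := fun e => hne (Subtype.ext e)
  have hLpos : 0 < L := by
    have : (0 : ℝ) < L := lt_of_le_of_lt (by positivity) hL
    exact_mod_cast this
  have hlen := congrArg List.length h
  simp only [List.length_take] at hlen
  have hrL : L ≤ r.length := by
    by_contra! hlt
    rw [List.take_of_length_le hlt.le, List.take_of_length_le (by omega)] at h
    exact hne' h
  have hrL' : L ≤ r'.length := by omega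
  have o : OccursAt (r.take L) r true 0 := ⟨by omega, by simpa [orient] using List.take_prefix L r⟩
  have o' : OccursAt (r.take L) r' true 0 :=
    ⟨by omega, by simpa [orient, h] using List.take_prefix L r'⟩
  have hmem : r ∈ relators A := ⟨⟨r, hr⟩, hrA, rfl⟩
  have := hA (r.take L) ⟨r, hmem, r', ⟨⟨r', hr'⟩, hrA', rfl⟩, true, true, 0, 0, o, o',
    fun e => hne' (congrArg Prod.fst e)⟩ r hmem ⟨true, 0, o⟩
  rw [List.length_take, min_eq_left hrL] at this
  have hrℓ : (r.length : ℝ) ≤ ℓ := by exact_mod_cast (mem_B.1 hr).2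
  nlinarith

/-! ### Asymptotics -/

theorem tendsto_succ_pow_mul_rpow {q s : ℝ} (hq : 1 < q) (hs : s < 0) (a : ℕ) :
    Tendsto (fun ℓ : ℕ => ((ℓ : ℝ) + 1) ^ a * q ^ (s * ℓ)) atTop (𝓝 0) := by
  have hq0 : 0 < q := by linarith
  have hr : |q ^ s| < 1 := by
    rw [abs_of_pos (Real.rpow_pos_of_pos hq0 s)]
    exact Real.rpow_lt_one_of_one_lt_of_neg hq hs
  have h := ((tendsto_pow_const_mul_const_pow_of_abs_lt_one a hr).comp
    (tendsto_add_atTop_nat 1)).mul_const ((q ^ s)⁻¹)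
  rw [zero_mul] at h
  refine h.congr fun ℓ => ?_
  have : q ^ s ≠ 0 := (Real.rpow_pos_of_pos hq0 s).ne'
  simp only [Function.comp_apply]
  rw [Real.rpow_mul hq0.le, Real.rpow_natCast, pow_succ]
  push_cast
  field_simp

theorem one_lt_two_mul_sub_one {m : ℕ} (hm : 2 ≤ m) : (1 : ℝ) < 2 * m - 1 := by
  have : (2 : ℝ) ≤ m := by exact_mod_cast hm
  linarith

theorem rpow_le_card_B {m : ℕ} (hm : 2 ≤ m) {ℓ : ℕ} (hℓ : 2 ≤ ℓ) :
    (2 * m - 1 : ℝ) ^ ((ℓ : ℝ) - 2) ≤ (B m ℓ).card := by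
  have h : (((2 * m - 1) ^ (ℓ - 2) : ℕ) : ℝ) ≤ (B m ℓ).card := by
    exact_mod_cast pow_le_card_B hm hℓ
  rw [Nat.cast_pow, cast_two_mul_sub_one (by omega), ← Real.rpow_natCast, Nat.cast_sub hℓ] at h
  exact_mod_cast h

theorem card_le_rpow_of_density_lt {α : Type*} {E : Finset α} (hE : 1 < E.card) {A : Finset E}
    {x : ℝ} (h : density E A < x) : (A.card : ℝ) ≤ (E.card : ℝ) ^ x := by
  have hE' : (1 : ℝ) < E.card := by exact_mod_cast hE
  by_cases hA : A.card = 0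
  · rw [hA, Nat.cast_zero]
    positivity
  · rw [density, if_neg hA, EReal.coe_lt_coe_iff] at h
    exact ((Real.logb_lt_iff_lt_rpow hE' (by positivity)).1 h).le

theorem rpow_le_card_of_lt_density {α : Type*} {E : Finset α} (hE : 1 < E.card) {A : Finset E}
    {x : ℝ} (h : x < density E A) : (E.card : ℝ) ^ x ≤ A.card := by
  have hE' : (1 : ℝ) < E.card := by exact_mod_cast hE
  by_cases hA : A.card = 0
  · rw [density, if_pos hA] at h
    exact absurd h (not_lt_bot)
  · rw [density, if_neg hA, EReal.coe_lt_coe_iff] at h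
    exact ((Real.lt_logb_iff_rpow_lt hE' (by positivity)).1 h).le

theorem AAS.mono_eventually {Ω : ℕ → Type*} [∀ ℓ, MeasurableSpace (Ω ℓ)]
    {P : ∀ ℓ, Measure (Ω ℓ)} [∀ ℓ, IsProbabilityMeasure (P ℓ)] {Q Q' : ∀ ℓ, Ω ℓ → Prop}
    (h : AAS P Q) (hQ : ∀ᶠ ℓ in atTop, ∀ ω, Q ℓ ω → Q' ℓ ω) : AAS P Q' :=
  tendsto_of_tendsto_of_tendsto_of_le_of_le' h tendsto_const_nhds
    (hQ.mono fun _ hℓ => measure_mono fun ω => hℓ ω) (Eventually.of_forall fun _ => prob_le_one)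

theorem eventually_one_lt_card_B {m : ℕ} (hm : 2 ≤ m) : ∀ᶠ ℓ in atTop, 1 < (B m ℓ).card := by
  filter_upwards [eventually_ge_atTop 3] with ℓ hℓ
  exact (Nat.one_lt_pow (by omega) (by omega)).trans_le (pow_le_card_B hm (by omega))

/-! ### The two sides of the threshold. -/

theorem aas_smallCancellation {Ω : ℕ → Type*} [∀ ℓ, MeasurableSpace (Ω ℓ)]
    (P : ∀ ℓ, Measure (Ω ℓ)) [∀ ℓ, IsProbabilityMeasure (P ℓ)]
    {m : ℕ} (hm : 2 ≤ m) {d : EReal} {lam : ℝ} (hlam0 : 0 < lam) (hlam1 : lam < 1)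
    (R : ∀ ℓ, Ω ℓ → Finset (B m ℓ)) (hR : IsRandomGroupSequence P m d R)
    (hd : d < ((lam / 2 : ℝ) : EReal)) :
    AAS P fun ℓ ω => SmallCancellation lam (relators (R ℓ ω)) := by
  classical
  obtain ⟨x, hdx, hx⟩ := EReal.lt_iff_exists_real_btwn.1 hd
  rw [EReal.coe_lt_coe_iff] at hx
  have hq := one_lt_two_mul_sub_one hm
  set q : ℝ := 2 * m - 1 with hq_def
  have hq0 : 0 < q := by linarith
  have hK : AAS P fun ℓ ω => (R ℓ ω).card ∈ {k : ℕ | (k : ℝ) ≤ ((B m ℓ).card : ℝ) ^ x} := by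
    refine AAS.mono_eventually (hR.densable (Set.Iio x) (Iio_mem_nhds hdx)) ?_
    filter_upwards [eventually_one_lt_card_B hm] with ℓ hℓ ω h
    exact card_le_rpow_of_density_lt hℓ h
  -- Upper bound for `k/N ≤ N ^ (x - 1)`: since `x < 1`, the lower bound `q ^ (ℓ - 2)` for `N` is
  -- the one needed.
  let t : ℕ → ℝ := fun ℓ => q ^ ((x - 1) * ((ℓ : ℝ) - 2))
  let ε : ℕ → ℝ := fun ℓ =>
    4 * (ℓ + 1) ^ 4 * ((2 * m) ^ 2 * q ^ ((2 - lam) * ℓ)) * t ℓ ^ 2 +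
      4 * (ℓ + 1) ^ 3 * ((2 * m) * q ^ ((1 - lam / 2) * ℓ)) * t ℓ
  have hε : Tendsto ε atTop (𝓝 0) := by
    have h1 := (tendsto_succ_pow_mul_rpow hq (show 2 * x - lam < 0 by linarith) 4).const_mul
      (4 * (2 * m : ℝ) ^ 2 * q ^ (-4 * (x - 1)))
    have h2 := (tendsto_succ_pow_mul_rpow hq (show x - lam / 2 < 0 by linarith) 3).const_mul
      (4 * (2 * m : ℝ) * q ^ (-2 * (x - 1)))
    have h3 := h1.add h2
    rw [mul_zero, mul_zero, add_zero] at h3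
    refine h3.congr fun ℓ => ?_
    have e1 : q ^ (-4 * (x - 1)) * q ^ ((2 * x - lam) * ℓ) = q ^ ((2 - lam) * ℓ) * t ℓ ^ 2 := by
      simp only [t]
      rw [← Real.rpow_natCast, ← Real.rpow_mul hq0.le, ← Real.rpow_add hq0, ← Real.rpow_add hq0]
      congr 1
      push_cast
      ring
    have e2 : q ^ (-2 * (x - 1)) * q ^ ((x - lam / 2) * ℓ) = q ^ ((1 - lam / 2) * ℓ) * t ℓ := by
      simp only [t]
      rw [← Real.rpow_add hq0, ← Real.rpow_add hq0]
      congr 1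
      ring
    simp only [ε]
    linear_combination (4 * (2 * m : ℝ) ^ 2 * (ℓ + 1) ^ 4) * e1 +
      (4 * (2 * m : ℝ) * (ℓ + 1) ^ 3) * e2
  have main := aas_not_of_card_le P R hR.randomSubset hR.permutationInvariant
    (fun ℓ A => ¬ SmallCancellation lam (relators A)) _ hK ε hε ?_ ?_
  · simpa only [not_not] using main
  · filter_upwards [eventually_ge_atTop 2, eventually_one_lt_card_B hm] with ℓ hℓ hN k hk
    have hN0 : (0 : ℝ) < (B m ℓ).card := by exact_mod_cast (show 0 < (B m ℓ).card by omega)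
    have hkt : (k : ℝ) / (B m ℓ).card ≤ t ℓ := by
      calc (k : ℝ) / (B m ℓ).card ≤ ((B m ℓ).card : ℝ) ^ x / (B m ℓ).card := by
            gcongr
        _ = ((B m ℓ).card : ℝ) ^ (x - 1) := by rw [Real.rpow_sub_one hN0.ne']
        _ ≤ (q ^ ((ℓ : ℝ) - 2)) ^ (x - 1) :=
            Real.rpow_le_rpow_of_nonpos (Real.rpow_pos_of_pos hq0 _) (rpow_le_card_B hm hℓ)
              (by linarith)
        _ = t ℓ := by rw [← Real.rpow_mul hq0.le, mul_comm]
    refine (card_not_smallCancellation_le hlam0.le k).trans ?_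
    have hp := card_pairsWithCommonSubword_le (show 1 ≤ m by omega) ℓ hlam1.le
    have hs := card_relatorsWithRepetition_le (show 1 ≤ m by omega) ℓ hlam1.le
    rw [← hq_def] at hp hs
    simp only [ε]
    gcongr
  · exact Eventually.of_forall fun ℓ => by positivity

theorem aas_not_smallCancellation {Ω : ℕ → Type*} [∀ ℓ, MeasurableSpace (Ω ℓ)]
    (P : ∀ ℓ, Measure (Ω ℓ)) [∀ ℓ, IsProbabilityMeasure (P ℓ)]
    {m : ℕ} (hm : 2 ≤ m) {d : EReal} {lam : ℝ} (hlam0 : 0 < lam) (hlam1 : lam < 1)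
    (R : ∀ ℓ, Ω ℓ → Finset (B m ℓ)) (hR : IsRandomGroupSequence P m d R)
    (hd : ((lam / 2 : ℝ) : EReal) < d) :
    AAS P fun ℓ ω => ¬ SmallCancellation lam (relators (R ℓ ω)) := by
  classical
  obtain ⟨x, hx, hdx⟩ := EReal.lt_iff_exists_real_btwn.1 hd
  rw [EReal.coe_lt_coe_iff] at hx
  have hx0 : 0 < x := by linarith
  have hm0 : (0 : ℝ) < m := by exact_mod_cast (show 0 < m by omega)
  have hq := one_lt_two_mul_sub_one hm
  set q : ℝ := 2 * m - 1 with hq_def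
  have hq0 : 0 < q := by linarith
  have hK : AAS P fun ℓ ω => (R ℓ ω).card ∈ {k : ℕ | ((B m ℓ).card : ℝ) ^ x ≤ k} := by
    refine AAS.mono_eventually (hR.densable (Set.Ioi x) (Ioi_mem_nhds hdx)) ?_
    filter_upwards [eventually_one_lt_card_B hm] with ℓ hℓ ω h
    exact rpow_le_card_of_lt_density hℓ h
  -- `M'` bounds the number of prefixes from above, and `y` bounds the typical `k` from below.
  let M' : ℕ → ℝ := fun ℓ => 4 * m * (ℓ + 1) * q ^ (lam * ℓ + 1)
  let y : ℕ → ℝ := fun ℓ => q ^ (x * ((ℓ : ℝ) - 2))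
  have hM'0 : ∀ ℓ, 0 < M' ℓ := fun ℓ => by positivity
  have hy0 : ∀ ℓ, 0 < y ℓ := fun ℓ => by positivity
  have hy : Tendsto y atTop atTop := by
    refine (tendsto_rpow_atTop_of_base_gt_one q hq).comp ?_
    exact Tendsto.const_mul_atTop hx0
      (tendsto_atTop_add_const_right _ (-2) tendsto_natCast_atTop_atTop)
  have hz : Tendsto (fun ℓ => M' ℓ / y ℓ ^ 2) atTop (𝓝 0) := by
    have h := (tendsto_succ_pow_mul_rpow hq (show lam - 2 * x < 0 by linarith) 1).const_mul
      (4 * m * q ^ (1 + 4 * x))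
    rw [mul_zero] at h
    refine h.congr fun ℓ => ?_
    rw [eq_div_iff (by positivity)]
    have e : q ^ (1 + 4 * x) * q ^ ((lam - 2 * x) * ℓ) * y ℓ ^ 2 = q ^ (lam * ℓ + 1) := by
      simp only [y]
      rw [← Real.rpow_natCast, ← Real.rpow_mul hq0.le, ← Real.rpow_add hq0, ← Real.rpow_add hq0]
      congr 1
      push_cast
      ring
    simp only [M']
    linear_combination (4 * m * (ℓ + 1) : ℝ) * e
  -- Since `λ < 1`, the prefixes are eventually at most half as many as the relators, as the
  -- birthday estimate requires.
  have hMN : Tendsto (fun ℓ : ℕ => M' ℓ / q ^ ((ℓ : ℝ) - 2)) atTop (𝓝 0) := by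
    have h := (tendsto_succ_pow_mul_rpow hq (show lam - 1 < 0 by linarith) 1).const_mul
      (4 * m * q ^ (3 : ℝ))
    rw [mul_zero] at h
    refine h.congr fun ℓ => ?_
    rw [eq_div_iff (by positivity)]
    have e : q ^ (3 : ℝ) * q ^ ((lam - 1) * ℓ) * q ^ ((ℓ : ℝ) - 2) = q ^ (lam * ℓ + 1) := by
      rw [← Real.rpow_add hq0, ← Real.rpow_add hq0]
      congr 1
      ring
    simp only [M']
    linear_combination (4 * m * (ℓ + 1) : ℝ) * e
  -- The `8` comes from `k(k-1)/(4M) ≥ k²/(8M)`, valid for `k ≥ 2`.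
  let ε : ℕ → ℝ := fun ℓ => Real.exp (-((M' ℓ / y ℓ ^ 2)⁻¹ / 8))
  have hε : Tendsto ε atTop (𝓝 0) := by
    refine Real.tendsto_exp_neg_atTop_nhds_zero.comp (Tendsto.atTop_div_const (by norm_num) ?_)
    refine Tendsto.inv_tendsto_nhdsGT_zero (tendsto_nhdsWithin_iff.2 ⟨hz, ?_⟩)
    exact Eventually.of_forall fun ℓ => Set.mem_Ioi.2 (div_pos (hM'0 ℓ) (by positivity))
  refine aas_not_of_card_le P R hR.randomSubset hR.permutationInvariant
    (fun ℓ A => SmallCancellation lam (relators A)) _ hK ε hε ?_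
    (Eventually.of_forall fun ℓ => (Real.exp_pos _).le)
  filter_upwards [eventually_ge_atTop 2, eventually_one_lt_card_B hm,
    hy.eventually_ge_atTop 2, hMN.eventually_le_const (show (0 : ℝ) < 1 / 2 by norm_num)]
    with ℓ hℓ hN hy2 hMN' k hk
  have hℓ0 : (0 : ℝ) ≤ ℓ := Nat.cast_nonneg _
  set L := ⌊lam * ℓ⌋₊ + 1 with hL
  have hL1 : lam * ℓ < L := by
    rw [hL]
    push_cast
    exact Nat.lt_floor_add_one _
  have hL2 : (L : ℝ) ≤ lam * ℓ + 1 := by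
    rw [hL]
    push_cast
    linarith [Nat.floor_le (show 0 ≤ lam * ℓ by positivity)]
  let c : B m ℓ → Word m := fun r => r.1.take L
  set M := (Finset.univ.image c).card with hM
  have hMM' : (M : ℝ) ≤ M' ℓ := by
    have h : (M : ℝ) ≤ (L + 1) * (2 * m * (((2 * m - 1) ^ L : ℕ) : ℝ)) := by
      exact_mod_cast card_image_take_le (show 1 ≤ m by omega) ℓ L
    refine h.trans ?_
    have h2 := pow_le_rpow (show 1 ≤ m by omega) hL2
    rw [← hq_def] at h2
    calc (L + 1) * (2 * m * (((2 * m - 1) ^ L : ℕ) : ℝ))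
        ≤ (2 * (ℓ + 1)) * (2 * m * q ^ (lam * ℓ + 1)) := by
          gcongr
          nlinarith
      _ = M' ℓ := by
          simp only [M']
          ring
  have hM0 : 0 < M := by
    obtain ⟨r, hr⟩ := Finset.card_pos.1 (show 0 < (B m ℓ).card by omega)
    exact Finset.card_pos.2 ⟨_, Finset.mem_image_of_mem c (Finset.mem_univ ⟨r, hr⟩)⟩
  have h2MN : 2 * M ≤ Fintype.card (B m ℓ) := by
    rw [Fintype.card_coe]
    have h := rpow_le_card_B hm hℓ
    rw [← hq_def] at h
    rw [div_le_iff₀ (by positivity)] at hMN'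
    have : 2 * (M : ℝ) ≤ (B m ℓ).card := by linarith
    exact_mod_cast this
  have hsub : (Finset.powersetCard k Finset.univ).filter
      (fun A : Finset (B m ℓ) => SmallCancellation lam (relators A)) ⊆ injSets c k := by
    intro A hA
    obtain ⟨h1, h2⟩ := Finset.mem_filter.1 hA
    exact mem_injSets.2 ⟨(Finset.mem_powersetCard.1 h1).2,
      injOn_take_of_smallCancellation hlam0.le hL1 h2⟩
  have hcard := card_injSets_le hM0 h2MN k
  rw [Fintype.card_coe] at hcard
  have hle : (((Finset.powersetCard k Finset.univ).filter
      (fun A : Finset (B m ℓ) => SmallCancellation lam (relators A))).card : ℝ) ≤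
      (injSets c k).card := by exact_mod_cast Finset.card_le_card hsub
  refine (hle.trans hcard).trans ?_
  have hyk : y ℓ ≤ k := by
    refine le_trans ?_ hk
    have h := Real.rpow_le_rpow (by positivity) (rpow_le_card_B hm hℓ) hx0.le
    rwa [← hq_def, ← Real.rpow_mul hq0.le, mul_comm] at h
  have hMpos : (0 : ℝ) < M := by exact_mod_cast hM0
  have hexp : (M' ℓ / y ℓ ^ 2)⁻¹ / 8 ≤ k * (k - 1) / (4 * M) := by
    rw [inv_div, div_div, div_le_div_iff₀ (mul_pos (hM'0 ℓ) (by norm_num)) (by positivity)]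
    have h1 : y ℓ ^ 2 ≤ 2 * (k * (k - 1)) := by nlinarith
    calc y ℓ ^ 2 * (4 * M) ≤ (2 * (k * (k - 1))) * (4 * M' ℓ) := by
          have := hy0 ℓ
          gcongr
          exact (sq_nonneg _).trans h1
      _ = _ := by ring
  have hmono : Real.exp (-(k * (k - 1) / (4 * M))) ≤ ε ℓ :=
    Real.exp_le_exp.2 (neg_le_neg hexp)
  exact mul_le_mul_of_nonneg_right hmono (Nat.cast_nonneg _)

end RandomGroup

theorem mainTheorem4 {Ω : ℕ → Type*} [∀ ℓ, MeasurableSpace (Ω ℓ)]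
    (P : ∀ ℓ, Measure (Ω ℓ)) [∀ ℓ, IsProbabilityMeasure (P ℓ)]
    (m : ℕ) (hm : 2 ≤ m) (d : EReal) (lam : ℝ) (hlam0 : 0 < lam) (hlam1 : lam < 1)
    (R : ∀ ℓ, Ω ℓ → Finset (RandomGroup.B m ℓ))
    (hR : RandomGroup.IsRandomGroupSequence P m d R) :
    (d < ((lam / 2 : ℝ) : EReal) →
      RandomGroup.AAS P fun ℓ ω =>
        RandomGroup.SmallCancellation lam (RandomGroup.relators (R ℓ ω))) ∧
    (((lam / 2 : ℝ) : EReal) < d →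
      RandomGroup.AAS P fun ℓ ω =>
        ¬ RandomGroup.SmallCancellation lam (RandomGroup.relators (R ℓ ω))) :=
  ⟨RandomGroup.aas_smallCancellation P hm hlam0 hlam1 R hR,
    RandomGroup.aas_not_smallCancellation P hm hlam0 hlam1 R hR⟩
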